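/- Let $\mathbb K\in\{\mathbb R,\mathbb C\}$ and $\mathbb N=\{1,2,\dots\}$. Finite subsets of $\mathbb N$ are identified with strictly increasing finite sequences, $\preceq$ denotes the initial segment order, $E<F$ means $\max E<\min F$, and $MAX(\mathcal F)$ is the set of $\preceq$-maximal members of a family $\mathcal F$ of finite sets. **Schreier families.** Let $\mathcal S_0=\{\varnothing\}\cup\{\{n\}:n\in\mathbb N\}$; let $\mathcal S_{\xi+1}$ consist of $\varnothing$ and of all $E_1\cup\dots\cup E_m$ with $E_1<\dots<E_m$, $\varnothing\ne E_n\in\mathcal S_\xi$, $m\le\min E_1$; for a countable limit ordinal $\xi$ fix a sequence $\xi_n\uparrow\xi$ and let $\mathcal S_\xi=\{\varnothing\}\cup\{E\neq\varnothing:\exists\, n\le \min E,\ E\in\mathcal S_{\xi_n+1}\}$. The sequences are chosen so that $\mathcal S_{\xi_n+1}\subset\mathcal S_{\xi_{n+1}}$ for all $n$; the result holds for every such choice. Let $\mathcal S_\zeta[\mathcal S_\xi]$ consist of $\varnothing$ and of all $E_1\cup\dots\cup E_m$ with $E_1<\dots<E_m$, $\varnothing\neq E_n\in\mathcal S_\xi$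 and $\{\min E_1,\dots,\min E_m\}\in\mathcal S_\zeta$. For $\mathcal F=\mathcal S_\xi$ or $\mathcal F=\mathcal S_\zeta[\mathcal S_\xi]$, every infinite $M\subset\mathbb N$ is uniquely a union of successive members of $MAX(\mathcal F)$, and every finite $E\ne\varnothing$ is uniquely a union $E_1\cup\dots\cup E_m$ of successive non-empty members of $\mathcal F$ with $E_n\in MAX(\mathcal F)$ for $n<m$; write $\ell_{\mathcal F}(E)=E_m$ for the last piece. **Weights.** For finite $E\neq\varnothing$ let $p^0_E=1$; $p^{\xi+1}_E=p^\xi_{F}/\min E'$ with $E'=\ell_{\mathcal S_{\xi+1}}(E)$, $F=\ell_{\mathcal S_\xi}(E')$; and for a limit $\xi$, $p^\xi_E=p^{\xi_{\min E'}+1}_{E'}$ with $E'=\ell_{\mathcal S_\xi}(E)$. Let $q^{\xi,0}_E=1$; $q^{\xi,\zeta+1}_E=q^{\xi,\zeta}_{F}/\sqrt{\min E'}$ with $E'=\ell_{\mathcal S_{\zeta+1}[\mathcal S_\xi]}(E)$, $F=\ell_{\mathcal S_\zeta[\mathcal S_\xi]}(E')$; and for a limit $\zeta$, $q^{\xi,\zeta}_E=q^{\xi,\zeta_{\min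 E'}+1}_{E'}$ with $E'=\ell_{\mathcal S_\zeta[\mathcal S_\xi]}(E)$. **The quantity $\mathfrak g_{\xi,\zeta}$.** Let $U$ be a Banach space over $\mathbb K$ with closed unit ball $B_U$. A collection $\mathfrak u=(u_E)$ in $U$, indexed by the non-empty finite $E\subset\mathbb N$, is weakly null if for each finite (possibly empty) $F\subset\mathbb N$ the sequence $(u_{F\cup\{k\}})_{k>F}$ is weakly null. For an infinite $M\subset\mathbb N$ with $\mathcal S_\zeta[\mathcal S_\xi]$-decomposition $M=\bigcup_k E_k$, put $$\mathbb E^{(2)}_{\xi,\zeta,M}\mathfrak u(n)=\sum_{E_1\cup\dots\cup E_{n-1}\prec E\preceq E_1\cup\dots\cup E_n}q^{\xi,\zeta}_E\,p^\xi_E\,u_E .$$ For a sequence $(x_n)$ in $U$ let $\|(x_n)\|_1^w=\sup\{\sum_n|\langle x^*,x_n\rangle|:x^*\in U^*,\ \|x^*\|\le1\}$. Then $\mathfrak g_{\xi,\zeta}(U)\in[0,\infty]$ is the infimum of all $\gamma\ge0$ such that for every weakly null collection $\mathfrak u$ in $B_U$ and every infinite $L\subset\mathbb N$ there is an infinite $M\subset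 L$ with $\|(\mathbb E^{(2)}_{\xi,\zeta,M}\mathfrak u(n))_{n\ge1}\|_1^w\le\gamma$ (and $\infty$ if there is no such $\gamma$). For an ordinal $\alpha$, let $C_0(\alpha)$ be the space of continuous functions $f:[0,\alpha]\to\mathbb K$ (order topology) with $f(\alpha)=0$, under the supremum norm, and let $\widehat\otimes_\pi$ denote the completed projective tensor product. **Theorem.** For all ordinals $\zeta\le\xi<\omega_1$, $$\mathfrak g_{\xi,1+\zeta}\bigl(C_0(\omega^{\omega^\xi})\,\widehat\otimes_\pi\,C_0(\omega^{\omega^\zeta})\bigr)\ \ge\ 1 .$$ -/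

import Mathlib

set_option maxSynthPendingDepth 3

open Filter Topology
open scoped TensorProduct Ordinal ENNReal NNReal

noncomputable section

namespace SchreierTensor

/-! ### Families of finite sets of positive integers -/

/-- `A` is an initial segment of `E`, i.e. `A ⪯ E` when finite sets of positive integers are
identified with strictly increasing finite sequences. -/
def IsInitial (A E : Finset ℕ+) : Prop :=
  A ⊆ E ∧ ∀ x ∈ E, ∀ y ∈ A, x ≤ y → x ∈ A

/-- The least element of a non-empty finite set (and `1` for the empty set). -/
def minElt (E : Finset ℕ+) : ℕ+ :=
  if h : E.Nonempty then E.min' h else 1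

/-- `A 0 < A 1 < ... < A (m - 1)` are non-empty successive sets. -/
def IsSuccessive {m : ℕ} (A : Fin m → Finset ℕ+) : Prop :=
  (∀ i, (A i).Nonempty) ∧ ∀ i j, i < j → ∀ x ∈ A i, ∀ y ∈ A j, x < y

/-- The convolution `F[G]`: unions `⋃ Eₙ` of non-empty successive members of `G` whose set of
minima belongs to `F`, together with the empty set. -/
def conv (F G : Set (Finset ℕ+)) : Set (Finset ℕ+) :=
  {E | E = ∅ ∨ ∃ (m : ℕ) (A : Fin m → Finset ℕ+), IsSuccessive A ∧ (∀ i, A i ∈ G) ∧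
    Finset.univ.image (fun i => minElt (A i)) ∈ F ∧ E = Finset.univ.biUnion A}

/-- A choice, for each limit ordinal `ξ`, of a sequence `(ξₙ)` of smaller ordinals, indexed by
the positive integers. -/
structure LimitSequences where
  seq : Ordinal.{0} → ℕ+ → Ordinal.{0}
  lt : ∀ ξ n, Order.IsSuccLimit ξ → seq ξ n < ξ

/-- The Schreier family `S_ξ` associated with a choice of sequences:
`S_0` consists of `∅` and the singletons; `S_{ξ+1}` consists of `∅` and of the unions
`E₁ ∪ ... ∪ Eₘ` of non-empty successive members of `S_ξ` with `m ≤ min E₁`; for a limit ordinal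
`ξ`, `S_ξ` consists of `∅` and of the sets `E ∈ S_{ξₙ+1}` with `n ≤ min E` for some `n`. -/
def schreier (c : LimitSequences) (ξ : Ordinal.{0}) : Set (Finset ℕ+) :=
  Ordinal.limitRecOn (motive := fun _ => Set (Finset ℕ+)) ξ
    {E | E = ∅ ∨ ∃ n, E = {n}}
    (fun _ S => {E | E = ∅ ∨ ∃ (m : ℕ) (A : Fin m → Finset ℕ+), IsSuccessive A ∧
      (∀ i, A i ∈ S) ∧ E = Finset.univ.biUnion A ∧ ∀ x ∈ E, m ≤ (x : ℕ)})
    (fun η hη S => {E | E = ∅ ∨ ∃ n : ℕ+, (∀ x ∈ E, n ≤ x) ∧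
      E ∈ S (c.seq η n + 1) (hη.add_one_lt (c.lt η n hη))})

/-- The sequences are characteristic sequences: for each countable limit ordinal `ξ`, `ξₙ`
increases to `ξ`, and `S_{ξₙ+1} ⊆ S_{ξₙ₊₁}` (the family of the next term) for all `n`. -/
def LimitSequences.IsCharacteristic (c : LimitSequences) : Prop :=
  ∀ ξ : Ordinal.{0}, ξ < ω₁ → Order.IsSuccLimit ξ →
    StrictMono (c.seq ξ) ∧ IsLUB (Set.range (c.seq ξ)) ξ ∧
      ∀ n : ℕ+, schreier c (c.seq ξ n + 1) ⊆ schreier c (c.seq ξ (n + 1))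

/-! ### Decompositions into maximal members of a family -/

open Classical in
/-- The longest initial segment of the finite set `E` which belongs to the family `F`. -/
def firstBlock (F : Set (Finset ℕ+)) (E : Finset ℕ+) : Finset ℕ+ :=
  (E.powerset.filter (fun A => IsInitial A E ∧ A ∈ F)).sup id

theorem firstBlock_subset (F : Set (Finset ℕ+)) (E : Finset ℕ+) : firstBlock F E ⊆ E := by
  classical
  unfold firstBlock
  refine Finset.sup_le fun A hA => ?_
  exact Finset.mem_powerset.1 (Finset.mem_filter.1 hA).1

open Classical in
/-- The last set `Eₘ` in the canonical decomposition `E = E₁ ∪ ... ∪ Eₘ`, `E₁ < ... < Eₘ`, of the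
finite set `E`, in which `Eₙ` is the longest initial segment of `E \ (E₁ ∪ ... ∪ Eₙ₋₁)` belonging
to `F`. For the families `F` used below this is the unique decomposition into successive
non-empty members of `F` all of which, except possibly the last one, are maximal in `F`. -/
def lastBlock (F : Set (Finset ℕ+)) (E : Finset ℕ+) : Finset ℕ+ :=
  if firstBlock F E = ∅ ∨ firstBlock F E = E then E else lastBlock F (E \ firstBlock F E)
termination_by E.card
decreasing_by
  rename_i h
  refine Finset.card_lt_card (Finset.sdiff_ssubset (firstBlock_subset F E) ?_)
  exact Finset.nonempty_iff_ne_empty.2 fun h0 => h (Or.inl h0)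

/-! ### Weights -/

/-- The repeated averages weights `p^ξ_E`. -/
def avgWeight (c : LimitSequences) (ξ : Ordinal.{0}) : Finset ℕ+ → ℝ :=
  Ordinal.limitRecOn (motive := fun _ => Finset ℕ+ → ℝ) ξ
    (fun _ => 1)
    (fun η p E =>
      let Em := lastBlock (schreier c (η + 1)) E
      p (lastBlock (schreier c η) Em) / (minElt Em : ℝ))
    (fun η hη p E =>
      let Em := lastBlock (schreier c η) E
      p (c.seq η (minElt Em) + 1) (hη.add_one_lt (c.lt η _ hη)) Em)

/-- The square-root weights `q^{ξ,ζ}_E`, by induction on `ζ`. -/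
def sqrtWeight (c : LimitSequences) (ξ ζ : Ordinal.{0}) : Finset ℕ+ → ℝ :=
  Ordinal.limitRecOn (motive := fun _ => Finset ℕ+ → ℝ) ζ
    (fun _ => 1)
    (fun η q E =>
      let Em := lastBlock (conv (schreier c (η + 1)) (schreier c ξ)) E
      q (lastBlock (conv (schreier c η) (schreier c ξ)) Em) / √(minElt Em : ℝ))
    (fun η hη q E =>
      let Em := lastBlock (conv (schreier c η) (schreier c ξ)) E
      q (c.seq η (minElt Em) + 1) (hη.add_one_lt (c.lt η _ hη)) Em)

/-! ### Combinations along infinite sets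

An infinite set of positive integers is identified with the strictly increasing sequence
`M 0 < M 1 < ...` of its elements. -/

/-- The first `k` elements of `M`. -/
def initSeg (M : ℕ → ℕ+) (k : ℕ) : Finset ℕ+ := (Finset.range k).image M

/-- The cardinality of `E₁ ∪ ... ∪ Eₙ`, where `M = E₁ ∪ E₂ ∪ ...` is the decomposition of `M` in
which each `Eₙ` is the longest initial segment of `M \ (E₁ ∪ ... ∪ Eₙ₋₁)` belonging to `F`. -/
def cut (F : Set (Finset ℕ+)) (M : ℕ → ℕ+) : ℕ → ℕ
  | 0 => 0
  | n + 1 => sSup {k | (Finset.Ico (cut F M n) k).image M ∈ F}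

section Normed

variable {𝕜 : Type*} [RCLike 𝕜]

/-- The sequence `𝔼^{(2)}_{ξ,ζ,M} u` (indexed from `0`): its `n`-th term is the sum of
`q^{ξ,ζ}_E p^ξ_E u_E` over the initial segments `E` of `M` with
`E₁ ∪ ... ∪ Eₙ ≺ E ⪯ E₁ ∪ ... ∪ Eₙ₊₁`, where `(Eₖ)` is the `S_ζ[S_ξ]`-decomposition of `M`. -/
def ellTwoAvg (𝕜 : Type*) [RCLike 𝕜] {U : Type*} [NormedAddCommGroup U] [NormedSpace 𝕜 U]
    (c : LimitSequences) (ξ ζ : Ordinal.{0}) (M : ℕ → ℕ+) (u : Finset ℕ+ → U) (n : ℕ) : U :=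
  ∑ j ∈ Finset.Ico (cut (conv (schreier c ζ) (schreier c ξ)) M n)
      (cut (conv (schreier c ζ) (schreier c ξ)) M (n + 1)),
    ((sqrtWeight c ξ ζ (initSeg M (j + 1)) * avgWeight c ξ (initSeg M (j + 1)) : ℝ) : 𝕜) •
      u (initSeg M (j + 1))

/-- The weakly `1`-summing norm of a sequence, with values in `[0, ∞]`. -/
def weakOneNorm (𝕜 : Type*) [RCLike 𝕜] {U : Type*} [NormedAddCommGroup U] [NormedSpace 𝕜 U]
    (x : ℕ → U) : ℝ≥0∞ :=
  ⨆ (φ : StrongDual 𝕜 U) (_ : ‖φ‖ ≤ 1), ∑' n, ‖φ (x n)‖ₑ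

/-- A collection `(u_E)` indexed by the non-empty finite sets is weakly null if for each finite
set `F` (possibly empty) the sequence `(u_{F ∪ {k}})_{k > max F}` is weakly null. -/
def WeaklyNull (𝕜 : Type*) [RCLike 𝕜] {U : Type*} [NormedAddCommGroup U] [NormedSpace 𝕜 U]
    (u : Finset ℕ+ → U) : Prop :=
  ∀ (F : Finset ℕ+) (φ : StrongDual 𝕜 U),
    Tendsto (fun k : ℕ+ => φ (u (insert k F))) atTop (𝓝 0)

/-- The `γ`-`G_{ξ,ζ}` property of an operator. -/
def HasG {U V : Type*} [NormedAddCommGroup U] [NormedSpace 𝕜 U] [NormedAddCommGroup V]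
    [NormedSpace 𝕜 V] (c : LimitSequences) (ξ ζ : Ordinal.{0}) (A : U →L[𝕜] V) (γ : ℝ≥0) : Prop :=
  ∀ u : Finset ℕ+ → U, (∀ E, E.Nonempty → ‖u E‖ ≤ 1) → WeaklyNull 𝕜 u →
    ∀ L : ℕ → ℕ+, StrictMono L →
      ∃ M : ℕ → ℕ+, StrictMono M ∧ Set.range M ⊆ Set.range L ∧
        weakOneNorm 𝕜 (fun n => A (ellTwoAvg 𝕜 c ξ ζ M u n)) ≤ γ

/-- `𝔤_{ξ,ζ}(A)`: the infimum of the `γ ≥ 0` such that `A` has the `γ`-`G_{ξ,ζ}` property, and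
`∞` if there is none. -/
def gConst {U V : Type*} [NormedAddCommGroup U] [NormedSpace 𝕜 U] [NormedAddCommGroup V]
    [NormedSpace 𝕜 V] (c : LimitSequences) (ξ ζ : Ordinal.{0}) (A : U →L[𝕜] V) : ℝ≥0∞ :=
  ⨅ (γ : ℝ≥0) (_ : HasG c ξ ζ A γ), (γ : ℝ≥0∞)

/-- `𝔤_{ξ,ζ}(U)` is `𝔤_{ξ,ζ}` of the identity of `U`. -/
def gSpace (𝕜 : Type*) [RCLike 𝕜] (U : Type*) [NormedAddCommGroup U] [NormedSpace 𝕜 U]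
    (c : LimitSequences) (ξ ζ : Ordinal.{0}) : ℝ≥0∞ :=
  gConst c ξ ζ (ContinuousLinearMap.id 𝕜 U)

/-! ### Projective tensor products -/

variable (𝕜) (X Y : Type*) [NormedAddCommGroup X] [NormedSpace 𝕜 X] [NormedAddCommGroup Y]
  [NormedSpace 𝕜 Y]

/-- The algebraic tensor product `X ⊗ Y`, to be equipped with the projective norm. -/
def AlgTensor : Type _ := X ⊗[𝕜] Y

instance : AddCommGroup (AlgTensor 𝕜 X Y) := inferInstanceAs (AddCommGroup (X ⊗[𝕜] Y))

instance : Module 𝕜 (AlgTensor 𝕜 X Y) := inferInstanceAs (Module 𝕜 (X ⊗[𝕜] Y))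

/-- The linear map sending `∑ xᵢ ⊗ yᵢ` to the functional `b ↦ ∑ b(xᵢ, yᵢ)` on the space of bounded
bilinear forms on `X × Y`. -/
def evalBilin : AlgTensor 𝕜 X Y →ₗ[𝕜] StrongDual 𝕜 (X →L[𝕜] Y →L[𝕜] 𝕜) :=
  TensorProduct.lift (LinearMap.mk₂ 𝕜
    (fun x y => (ContinuousLinearMap.apply 𝕜 𝕜 y).comp (ContinuousLinearMap.apply 𝕜 (Y →L[𝕜] 𝕜) x))
    (fun x₁ x₂ y => by ext b; simp)
    (fun a x y => by ext b; simp)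
    (fun x y₁ y₂ => by ext b; simp)
    (fun a x y => by ext b; simp))

/-- The projective norm: `‖∑ xᵢ ⊗ yᵢ‖_π` is the supremum of `|∑ b(xᵢ, yᵢ)|` over the bounded
bilinear forms `b` of norm at most `1`, i.e. the norm of the functional `evalBilin`. -/
instance : SeminormedAddCommGroup (AlgTensor 𝕜 X Y) :=
  SeminormedAddCommGroup.induced _ _ (evalBilin 𝕜 X Y)

instance : NormedSpace 𝕜 (AlgTensor 𝕜 X Y) :=
  NormedSpace.induced _ _ _ (evalBilin 𝕜 X Y)

/-- The projective tensor product: the completion of `X ⊗ Y` for the projective norm. -/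
abbrev ProjTensor : Type _ := UniformSpace.Completion (AlgTensor 𝕜 X Y)

end Normed

/-! ### Spaces of continuous functions on ordinal intervals -/

/-- `C₀(α)`: the continuous functions on the compact ordinal interval `[0, α]` (with the order
topology) vanishing at `α`, with the supremum norm. -/
def C0 (𝕜 : Type*) [RCLike 𝕜] (α : Ordinal.{0}) : Submodule 𝕜 C(Set.Icc (0 : Ordinal.{0}) α, 𝕜) where
  carrier := {f | f ⟨α, Set.right_mem_Icc.2 zero_le⟩ = 0}
  add_mem' := fun {f g} hf hg => by
    simp only [Set.mem_ofPred_eq] at hf hg ⊢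
    simp [hf, hg]
  zero_mem' := by simp
  smul_mem' := fun a f hf => by
    simp only [Set.mem_ofPred_eq] at hf ⊢
    simp [hf]

end SchreierTensor

end

noncomputable section

namespace SchreierTensor

/-! ### Greedy decompositions -/

/-! One weakly null collection of pure tensors f_A ⊗ g_A in the unit ball is built such that, along
every infinite M, already the first term of the sequence 𝔼^(2) has norm at least 1. A norming
functional for that term (`one_le_weakOneNorm`) bounds the weakly 1-summing norm.

The factors. S_ξ carries a rank with value ω^ξ at ∅ (`exists_isRank_schreier`), so its non-empty
members can be given clopen intervals in [0, ω^(ω^ξ)), nested along end-extensions and disjoint for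
distinct sets of equal cardinality; f_A is the indicator of the interval of the last S_ξ-block of A.
Let D be the set of minima of the S_ξ-blocks of A and N the set of minima of the S_1-blocks of D. If
D ∈ S_{1+ζ}, then N ∈ S_ζ (`blockMins_mem_of_mem_one_add`). An S_1-block with minimum n has at most
n elements, so each element of D is coded by a pair (n, l) with n ∈ N and l ≤ n, one of finitely
many signs attached to n. Labelling the nodes of the tree of S_ζ by the values of these signs does
not raise the rank, and g_A takes on the labelled intervals of N the value of the sign coding max D:
a Rademacher-like function in C_0(ω^(ω^ζ)).

Lower bound. Over a complete block E the weights w_d = p^{1+ζ} of the initial parts of D add up to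
1, q is the square root of w (`sqrtWeight_eq`), and ∑ q²p = 1 (`initialSum_avgWeight_mul`). The
bilinear form (f, g) ↦ ∑_d √w_d f(x_d) 𝔼[ε_d g(y)] has norm at most 1 by orthogonality and
Cauchy–Schwarz (`norm_signForm_le`), and equals √w_d = q at the pairs belonging to d. Testing the
combination against it yields ∑ q²p = 1.

Weak nullity. Along A = F ∪ {k} the values of k split into three classes, on each of which the f's
are disjointly supported and the g's are constant or disjointly supported. Sign averaging then
bounds ∑ |φ(f_k ⊗ g_k)| by ‖φ‖ (`sum_norm_le_of_disjoint`). -/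

theorem notMem_of_forall_lt {E : Finset ℕ+} {k : ℕ+} (h : ∀ x ∈ E, x < k) : k ∉ E :=
  fun hk => lt_irrefl k (h k hk)

theorem filter_le_insert {E : Finset ℕ+} {k x : ℕ+} (h : ∀ x ∈ E, x < k) (hx : x ∈ E) :
    (insert k E).filter (· ≤ x) = E.filter (· ≤ x) := by
  rw [Finset.filter_insert, if_neg (not_le.2 (h x hx))]

theorem filter_le_insert_self {E : Finset ℕ+} {k : ℕ+} (h : ∀ x ∈ E, x < k) :
    (insert k E).filter (· ≤ k) = insert k E :=
  Finset.filter_true_of_mem fun x hx => by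
    rcases Finset.mem_insert.1 hx with rfl | hx
    exacts [le_rfl, (h x hx).le]

theorem minElt_mem {E : Finset ℕ+} (h : E.Nonempty) : minElt E ∈ E := by
  simp only [minElt, h, dite_true]
  exact Finset.min'_mem _ _

theorem minElt_le {E : Finset ℕ+} {x : ℕ+} (hx : x ∈ E) : minElt E ≤ x := by
  simp only [minElt, show E.Nonempty from ⟨x, hx⟩, dite_true]
  exact Finset.min'_le _ _ hx

theorem minElt_eq {E : Finset ℕ+} {x : ℕ+} (hx : x ∈ E) (h : ∀ y ∈ E, x ≤ y) : minElt E = x :=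
  le_antisymm (minElt_le hx) (h _ (minElt_mem ⟨x, hx⟩))

@[simp] theorem minElt_singleton (k : ℕ+) : minElt {k} = k :=
  minElt_eq (Finset.mem_singleton_self k) (by simp)

theorem minElt_insert {E : Finset ℕ+} {k : ℕ+} (h : ∀ x ∈ E, x < k) (hE : E.Nonempty) :
    minElt (insert k E) = minElt E := by
  refine minElt_eq (Finset.mem_insert_of_mem (minElt_mem hE)) fun y hy => ?_
  rcases Finset.mem_insert.1 hy with rfl | hy
  exacts [(h _ (minElt_mem hE)).le, minElt_le hy]

/-- Families containing the empty set and all singletons, and closed under removal of the largest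
element. -/
structure IsInitialClosed (F : Set (Finset ℕ+)) : Prop where
  empty_mem : ∅ ∈ F
  singleton_mem : ∀ n, {n} ∈ F
  of_insert : ∀ E k, (∀ x ∈ E, x < k) → insert k E ∈ F → E ∈ F

theorem isInitial_insert_iff {A E : Finset ℕ+} {k : ℕ+} (h : ∀ x ∈ E, x < k) :
    IsInitial A (insert k E) ↔ A = insert k E ∨ IsInitial A E := by
  constructor
  · rintro ⟨h1, h2⟩
    by_cases hk : k ∈ A
    · left
      refine Finset.Subset.antisymm h1 fun x hx => h2 x hx k hk ?_
      rcases Finset.mem_insert.1 hx with rfl | hx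
      exacts [le_rfl, (h x hx).le]
    · right
      refine ⟨fun x hx => ?_, fun x hx y hy hxy => h2 x (Finset.mem_insert_of_mem hx) y hy hxy⟩
      rcases Finset.mem_insert.1 (h1 hx) with rfl | hx'
      exacts [absurd hx hk, hx']
  · rintro (rfl | ⟨h1, h2⟩)
    · exact ⟨subset_rfl, fun x hx _ _ _ => hx⟩
    · refine ⟨h1.trans (Finset.subset_insert _ _), fun x hx y hy hxy => ?_⟩
      rcases Finset.mem_insert.1 hx with rfl | hx
      · exact absurd (h y (h1 hy)) (not_lt.2 hxy)
      · exact h2 x hx y hy hxy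

section Greedy

variable {F : Set (Finset ℕ+)}

theorem firstBlock_of_mem {E : Finset ℕ+} (h : E ∈ F) : firstBlock F E = E := by
  classical
  refine Finset.Subset.antisymm (firstBlock_subset F E) ?_
  unfold firstBlock
  exact Finset.le_sup (f := id) (Finset.mem_filter.2
    ⟨Finset.mem_powerset.2 subset_rfl, ⟨subset_rfl, fun x hx _ _ _ => hx⟩, h⟩)

theorem firstBlock_insert_of_notMem {E : Finset ℕ+} {k : ℕ+} (h : ∀ x ∈ E, x < k)
    (hF : insert k E ∉ F) : firstBlock F (insert k E) = firstBlock F E := by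
  classical
  unfold firstBlock
  congr 1
  ext A
  simp only [Finset.mem_filter, Finset.mem_powerset, isInitial_insert_iff h]
  constructor
  · rintro ⟨-, rfl | h2, h3⟩
    exacts [absurd h3 hF, ⟨h2.1, h2, h3⟩]
  · rintro ⟨h1, h2, h3⟩
    exact ⟨h1.trans (Finset.subset_insert _ _), Or.inr h2, h3⟩

theorem firstBlock_mem (hF : IsInitialClosed F) (E : Finset ℕ+) : firstBlock F E ∈ F := by
  induction E using Finset.induction_on_max with
  | empty => rw [firstBlock_of_mem hF.empty_mem]; exact hF.empty_mem
  | insert k E h ih =>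
    by_cases hm : insert k E ∈ F
    · rwa [firstBlock_of_mem hm]
    · rwa [firstBlock_insert_of_notMem h hm]

theorem firstBlock_nonempty (hF : IsInitialClosed F) {E : Finset ℕ+} (hE : E.Nonempty) :
    (firstBlock F E).Nonempty := by
  induction E using Finset.induction_on_max with
  | empty => exact absurd hE (by simp)
  | insert k E h ih =>
    by_cases hm : insert k E ∈ F
    · rwa [firstBlock_of_mem hm]
    · rw [firstBlock_insert_of_notMem h hm]
      refine ih (Finset.nonempty_iff_ne_empty.2 ?_)
      rintro rfl
      exact hm (by simpa using hF.singleton_mem k)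

theorem lastBlock_of_mem {E : Finset ℕ+} (h : E ∈ F) : lastBlock F E = E := by
  rw [lastBlock, if_pos (Or.inr (firstBlock_of_mem h))]

theorem lastBlock_empty (hF : IsInitialClosed F) : lastBlock F ∅ = ∅ :=
  lastBlock_of_mem hF.empty_mem

theorem lastBlock_of_notMem (hF : IsInitialClosed F) {E : Finset ℕ+} (h : E ∉ F) :
    lastBlock F E = lastBlock F (E \ firstBlock F E) := by
  have hE : E.Nonempty := Finset.nonempty_iff_ne_empty.2 fun h0 => h (h0 ▸ hF.empty_mem)
  rw [lastBlock, if_neg]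
  rintro (h1 | h1)
  · exact (firstBlock_nonempty hF hE).ne_empty h1
  · exact h (h1 ▸ firstBlock_mem hF E)

open Classical in
/-- Greedy recursion for the last block. -/
theorem lastBlock_insert (hF : IsInitialClosed F) {E : Finset ℕ+} {k : ℕ+} (h : ∀ x ∈ E, x < k) :
    lastBlock F (insert k E) =
      if insert k (lastBlock F E) ∈ F then insert k (lastBlock F E) else {k} := by
  induction hn : E.card using Nat.strong_induction_on generalizing E with
  | _ n ih =>
  by_cases hm : insert k E ∈ F
  · have hE := hF.of_insert E k h hm
    rw [lastBlock_of_mem hE, if_pos hm, lastBlock_of_mem hm]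
  -- The first block does not see `k`; removing it leaves a smaller set to which the induction
  -- applies.
  · rw [lastBlock_of_notMem hF hm, firstBlock_insert_of_notMem h hm]
    have hk : k ∉ firstBlock F E := fun hk =>
      notMem_of_forall_lt h (firstBlock_subset F E hk)
    rw [Finset.insert_sdiff_of_notMem _ hk]
    by_cases hE : E ∈ F
    · rw [firstBlock_of_mem hE, Finset.sdiff_self, lastBlock_of_mem hE, if_neg hm]
      exact lastBlock_of_mem (by simpa using hF.singleton_mem k)
    · have hE0 : E.Nonempty := Finset.nonempty_iff_ne_empty.2 fun h0 => hE (h0 ▸ hF.empty_mem)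
      rw [lastBlock_of_notMem hF hE]
      refine ih _ ?_ (fun x hx => h x (Finset.mem_sdiff.1 hx).1) rfl
      rw [← hn]
      exact Finset.card_lt_card (Finset.sdiff_ssubset (firstBlock_subset F E)
        (firstBlock_nonempty hF hE0))

theorem lastBlock_subset (hF : IsInitialClosed F) (E : Finset ℕ+) : lastBlock F E ⊆ E := by
  classical
  induction E using Finset.induction_on_max with
  | empty => rw [lastBlock_empty hF]
  | insert k E h ih =>
    rw [lastBlock_insert hF h]
    split_ifs
    · exact Finset.insert_subset_insert _ ih
    · simp

theorem lastBlock_mem (hF : IsInitialClosed F) (E : Finset ℕ+) : lastBlock F E ∈ F := by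
  classical
  induction E using Finset.induction_on_max with
  | empty => rw [lastBlock_empty hF]; exact hF.empty_mem
  | insert k E h ih =>
    rw [lastBlock_insert hF h]
    split_ifs with hm
    exacts [hm, hF.singleton_mem k]

theorem lastBlock_lastBlock (hF : IsInitialClosed F) (E : Finset ℕ+) :
    lastBlock F (lastBlock F E) = lastBlock F E :=
  lastBlock_of_mem (lastBlock_mem hF E)

theorem lastBlock_nonempty (hF : IsInitialClosed F) {E : Finset ℕ+} (hE : E.Nonempty) :
    (lastBlock F E).Nonempty := by
  classical
  induction E using Finset.induction_on_max with
  | empty => exact absurd hE (by simp)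
  | insert k E h ih =>
    rw [lastBlock_insert hF h]
    split_ifs <;> simp

theorem lastBlock_lt (hF : IsInitialClosed F) {E : Finset ℕ+} {k : ℕ+} (h : ∀ x ∈ E, x < k) :
    ∀ x ∈ lastBlock F E, x < k :=
  fun x hx => h x (lastBlock_subset hF E hx)

theorem lastBlock_singleton (hF : IsInitialClosed F) (k : ℕ+) : lastBlock F {k} = {k} :=
  lastBlock_of_mem (hF.singleton_mem k)

variable (F) in
open Classical in
/-- The set of minima of the blocks in the greedy decomposition of `E`. -/
def blockMins (E : Finset ℕ+) : Finset ℕ+ :=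
  E.filter fun x => lastBlock F (E.filter (· ≤ x)) = {x}

theorem blockMins_subset (E : Finset ℕ+) : blockMins F E ⊆ E := by
  classical
  exact Finset.filter_subset _ _

@[simp] theorem blockMins_empty : blockMins F ∅ = ∅ := by
  classical
  simp [blockMins]

open Classical in
theorem blockMins_insert {E : Finset ℕ+} {k : ℕ+} (h : ∀ x ∈ E, x < k) :
    blockMins F (insert k E) =
      if lastBlock F (insert k E) = {k} then insert k (blockMins F E) else blockMins F E := by
  have h1 : E.filter (fun x => lastBlock F ((insert k E).filter (· ≤ x)) = {x}) =
      blockMins F E := by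
    refine Finset.filter_congr fun x hx => ?_
    rw [filter_le_insert h hx]
  rw [blockMins, Finset.filter_insert, filter_le_insert_self h, h1]

/-- Appending an element either extends the last block or starts a new one. -/
theorem block_step (hF : IsInitialClosed F) {E : Finset ℕ+} {k : ℕ+} (h : ∀ x ∈ E, x < k) :
    (E.Nonempty ∧ insert k (lastBlock F E) ∈ F ∧
      lastBlock F (insert k E) = insert k (lastBlock F E) ∧
      blockMins F (insert k E) = blockMins F E) ∨
    ((E = ∅ ∨ insert k (lastBlock F E) ∉ F) ∧ lastBlock F (insert k E) = {k} ∧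
      blockMins F (insert k E) = insert k (blockMins F E)) := by
  classical
  rcases E.eq_empty_or_nonempty with rfl | hE
  · right
    have : lastBlock F (insert k ∅) = {k} := by simpa using lastBlock_singleton hF k
    rw [blockMins_insert h, if_pos this]
    exact ⟨Or.inl rfl, this, rfl⟩
  by_cases hm : insert k (lastBlock F E) ∈ F
  · left
    have h1 : lastBlock F (insert k E) = insert k (lastBlock F E) := by
      rw [lastBlock_insert hF h, if_pos hm]
    refine ⟨hE, hm, h1, ?_⟩
    rw [blockMins_insert h, if_neg]
    rw [h1]
    intro h2
    obtain ⟨y, hy⟩ := lastBlock_nonempty hF hE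
    have h3 : y = k := by
      have := Finset.mem_insert_of_mem (a := y) (b := k) hy
      rw [h2] at this
      simpa using this
    exact (lastBlock_lt hF h y hy).ne h3
  · right
    have h1 : lastBlock F (insert k E) = {k} := by
      rw [lastBlock_insert hF h, if_neg hm]
    refine ⟨Or.inr hm, h1, ?_⟩
    rw [blockMins_insert h, if_pos h1]

theorem blockMins_singleton (hF : IsInitialClosed F) (k : ℕ+) : blockMins F {k} = {k} := by
  rcases block_step hF (E := ∅) (k := k) (by simp) with h | h
  · simpa using h.1
  · simpa using h.2.2

theorem blockMins_lt {E : Finset ℕ+} {k : ℕ+} (h : ∀ x ∈ E, x < k) :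
    ∀ x ∈ blockMins F E, x < k :=
  fun x hx => h x (blockMins_subset E hx)

theorem blockMins_nonempty (hF : IsInitialClosed F) {E : Finset ℕ+} (hE : E.Nonempty) :
    (blockMins F E).Nonempty := by
  induction E using Finset.induction_on_max with
  | empty => exact absurd hE (by simp)
  | insert k E h ih =>
    rcases block_step hF h with h1 | h1
    · rw [h1.2.2.2]; exact ih h1.1
    · rw [h1.2.2]; simp

theorem minElt_blockMins (hF : IsInitialClosed F) (E : Finset ℕ+) :
    minElt (blockMins F E) = minElt E := by
  induction E using Finset.induction_on_max with
  | empty => simp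
  | insert k E h ih =>
    rcases E.eq_empty_or_nonempty with rfl | hE
    · simp [blockMins_singleton hF]
    rw [minElt_insert h hE, ← ih]
    rcases block_step hF h with h1 | h1
    · rw [h1.2.2.2]
    · rw [h1.2.2, minElt_insert (blockMins_lt h) (blockMins_nonempty hF hE)]

/-- The last block is a final segment, and its minimum is the last block minimum. -/
theorem lastBlock_eq_filter (hF : IsInitialClosed F) {E : Finset ℕ+} (hE : E.Nonempty) :
    lastBlock F E = E.filter (minElt (lastBlock F E) ≤ ·) ∧
      minElt (lastBlock F E) ∈ blockMins F E ∧
      ∀ x ∈ blockMins F E, x ≤ minElt (lastBlock F E) := by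
  induction E using Finset.induction_on_max with
  | empty => exact absurd hE (by simp)
  | insert k E h ih =>
    rcases block_step hF h with h1 | h1
    · obtain ⟨i1, i2, i3⟩ := ih h1.1
      rw [h1.2.2.1, h1.2.2.2, minElt_insert (lastBlock_lt hF h) (lastBlock_nonempty hF h1.1)]
      refine ⟨?_, i2, i3⟩
      rw [Finset.filter_insert, if_pos, ← i1]
      exact (h _ (blockMins_subset _ i2)).le
    · rw [h1.2.1, h1.2.2, minElt_singleton]
      refine ⟨?_, Finset.mem_insert_self _ _, fun x hx => ?_⟩
      · rw [Finset.filter_insert, if_pos le_rfl, Finset.filter_false_of_mem]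
        · rfl
        · exact fun x hx => not_le.2 (h x hx)
      · rcases Finset.mem_insert.1 hx with rfl | hx
        exacts [le_rfl, (blockMins_lt h x hx).le]

theorem minElt_lastBlock_mem_blockMins (hF : IsInitialClosed F) {E : Finset ℕ+}
    (hE : E.Nonempty) : minElt (lastBlock F E) ∈ blockMins F E :=
  (lastBlock_eq_filter hF hE).2.1

/-- Block minima of an initial segment. -/
theorem blockMins_filter_le (hF : IsInitialClosed F) {E : Finset ℕ+} {x : ℕ+} (hx : x ∈ E) :
    blockMins F (E.filter (· ≤ x)) =
      (blockMins F E).filter (· ≤ minElt (lastBlock F (E.filter (· ≤ x)))) := by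
  induction E using Finset.induction_on_max with
  | empty => exact absurd hx (by simp)
  | insert k E h ih =>
    rcases Finset.mem_insert.1 hx with rfl | hx'
    · rw [filter_le_insert_self h, Finset.filter_true_of_mem]
      exact (lastBlock_eq_filter hF ⟨x, hx⟩).2.2
    · rw [filter_le_insert h hx', ih hx']
      rcases block_step hF h with h1 | h1
      · rw [h1.2.2.2]
      · rw [h1.2.2, Finset.filter_insert, if_neg]
        refine not_le.2 (h _ ?_)
        exact Finset.filter_subset _ _ (lastBlock_subset hF _ (minElt_mem (lastBlock_nonempty hF
          ⟨x, Finset.mem_filter.2 ⟨hx', le_rfl⟩⟩)))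

/-- Splitting off the last block. -/
theorem exists_eq_union_lastBlock (hF : IsInitialClosed F) {E : Finset ℕ+} (hE : E.Nonempty) :
    ∃ E₀ : Finset ℕ+, E = E₀ ∪ lastBlock F E ∧ (∀ x ∈ E₀, ∀ y ∈ lastBlock F E, x < y) ∧
      blockMins F E = insert (minElt (lastBlock F E)) (blockMins F E₀) := by
  induction E using Finset.induction_on_max with
  | empty => exact absurd hE (by simp)
  | insert k E h ih =>
    rcases block_step hF h with h1 | h1
    · obtain ⟨E₀, i1, i2, i3⟩ := ih h1.1
      refine ⟨E₀, ?_, ?_, ?_⟩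
      · rw [h1.2.2.1, Finset.union_insert, ← i1]
      · rw [h1.2.2.1]
        intro x hx y hy
        rcases Finset.mem_insert.1 hy with rfl | hy
        · exact h x (by rw [i1]; exact Finset.mem_union_left _ hx)
        · exact i2 x hx y hy
      · rw [h1.2.2.1, h1.2.2.2, minElt_insert (lastBlock_lt hF h) (lastBlock_nonempty hF h1.1), i3]
    · refine ⟨E, ?_, ?_, ?_⟩
      · rw [h1.2.1, Finset.union_comm]; rfl
      · rw [h1.2.1]; simpa using h
      · rw [h1.2.1, h1.2.2, minElt_singleton]

/-- Translates the bookkeeping by `lastBlock` and `blockMins` back into the indexed unions through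
which `conv` and `schreier` are defined; pieces are peeled off from the end. -/
theorem exists_greedy_decomposition (hF : IsInitialClosed F) (E : Finset ℕ+) :
    ∃ A : Fin (blockMins F E).card → Finset ℕ+, IsSuccessive A ∧ (∀ i, A i ∈ F) ∧
      Finset.univ.image (fun i => minElt (A i)) = blockMins F E ∧ E = Finset.univ.biUnion A := by
  suffices H : ∃ (m : ℕ) (A : Fin m → Finset ℕ+), m = (blockMins F E).card ∧
      IsSuccessive A ∧ (∀ i, A i ∈ F) ∧
      Finset.univ.image (fun i => minElt (A i)) = blockMins F E ∧ E = Finset.univ.biUnion A by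
    obtain ⟨m, A, rfl, h⟩ := H
    exact ⟨A, h⟩
  induction hn : E.card using Nat.strong_induction_on generalizing E with
  | _ n ih =>
  rcases E.eq_empty_or_nonempty with rfl | hE
  · exact ⟨0, fun i => i.elim0, by simp, ⟨fun i => i.elim0, fun i => i.elim0⟩, fun i => i.elim0,
      by simp, by simp⟩
  obtain ⟨E₀, h1, h2, h3⟩ := exists_eq_union_lastBlock hF hE
  have hne := lastBlock_nonempty hF hE
  have hdisj : Disjoint E₀ (lastBlock F E) := by
    rw [Finset.disjoint_left]
    exact fun x hx hy => lt_irrefl _ (h2 x hx x hy)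
  have hcard : E₀.card < n := by
    have h5 := Finset.card_union_of_disjoint hdisj
    rw [← h1, hn] at h5
    have := hne.card_pos
    omega
  obtain ⟨m, A, a1, a2, a3, a4, a5⟩ := ih _ hcard E₀ rfl
  have hnm : minElt (lastBlock F E) ∉ blockMins F E₀ := fun h =>
    lt_irrefl _ (h2 _ (blockMins_subset _ h) _ (minElt_mem hne))
  have hsub : ∀ i, A i ⊆ E₀ := fun i => by
    conv_rhs => rw [a5]
    exact Finset.subset_biUnion_of_mem A (Finset.mem_univ i)
  refine ⟨m + 1, Fin.snoc (α := fun _ => Finset ℕ+) A (lastBlock F E), ?_, ⟨?_, ?_⟩, ?_, ?_, ?_⟩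
  · rw [h3, Finset.card_insert_of_notMem hnm, a1]
  · intro i
    refine Fin.lastCases ?_ (fun i => ?_) i
    · simpa using hne
    · simpa using a2.1 i
  · intro i j
    refine Fin.lastCases ?_ (fun j => ?_) j
    · refine Fin.lastCases ?_ (fun i => ?_) i
      · simp
      · intro _ x hx y hy
        simp only [Fin.snoc_castSucc, Fin.snoc_last] at hx hy
        exact h2 x (hsub i hx) y hy
    · refine Fin.lastCases ?_ (fun i => ?_) i
      · intro h; exact absurd h (not_lt.2 (Fin.castSucc_lt_last j).le)
      · intro h x hx y hy
        simp only [Fin.snoc_castSucc] at hx hy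
        exact a2.2 i j (by simpa using h) x hx y hy
  · intro i
    refine Fin.lastCases ?_ (fun i => ?_) i
    · simpa using lastBlock_mem hF E
    · simpa using a3 i
  · rw [h3, ← a4]
    ext x
    simp [Fin.exists_fin_succ', or_comm, eq_comm]
  · conv_lhs => rw [h1, a5]
    ext x
    simp [Fin.exists_fin_succ']

end Greedy

/-! ### Regular families -/

/-- `Y` is dominated by `X`: there is an increasing injection of `Y` into `X` which does not
increase any element, i.e. `Y` is a spread of a subset of `X`. -/
inductive Dominated : Finset ℕ+ → Finset ℕ+ → Prop
  | empty : Dominated ∅ ∅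
  | skip {Y X : Finset ℕ+} {x : ℕ+} (h : Dominated Y X) (hX : ∀ z ∈ X, z < x) :
      Dominated Y (insert x X)
  | add {Y X : Finset ℕ+} {y x : ℕ+} (h : Dominated Y X) (hY : ∀ z ∈ Y, z < y)
      (hX : ∀ z ∈ X, z < x) (hxy : x ≤ y) : Dominated (insert y Y) (insert x X)

namespace Dominated

theorem empty_left (X : Finset ℕ+) : Dominated ∅ X := by
  induction X using Finset.induction_on_max with
  | empty => exact .empty
  | insert k E h ih => exact .skip ih h

theorem refl (X : Finset ℕ+) : Dominated X X := by
  induction X using Finset.induction_on_max with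
  | empty => exact .empty
  | insert k E h ih => exact .add ih h h le_rfl

theorem card_le {Y X : Finset ℕ+} (h : Dominated Y X) : Y.card ≤ X.card := by
  induction h with
  | empty => simp
  | skip h hX ih => rw [Finset.card_insert_of_notMem (notMem_of_forall_lt hX)]; omega
  | add h hY hX hxy ih =>
    rw [Finset.card_insert_of_notMem (notMem_of_forall_lt hX),
      Finset.card_insert_of_notMem (notMem_of_forall_lt hY)]
    omega

theorem exists_le {Y X : Finset ℕ+} (h : Dominated Y X) : ∀ y ∈ Y, ∃ x ∈ X, x ≤ y := by
  induction h with
  | empty => simp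
  | skip h hX ih =>
    intro y hy
    obtain ⟨x, hx, hxy⟩ := ih y hy
    exact ⟨x, Finset.mem_insert_of_mem hx, hxy⟩
  | add h hY hX hxy ih =>
    intro y hy
    rcases Finset.mem_insert.1 hy with rfl | hy
    · exact ⟨_, Finset.mem_insert_self _ _, hxy⟩
    · obtain ⟨x, hx, hxy⟩ := ih y hy
      exact ⟨x, Finset.mem_insert_of_mem hx, hxy⟩

theorem of_subset {Y X : Finset ℕ+} (h : Y ⊆ X) : Dominated Y X := by
  induction X using Finset.induction_on_max generalizing Y with
  | empty => rw [Finset.subset_empty.1 h]; exact .empty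
  | insert k E hk ih =>
    by_cases hY : k ∈ Y
    · have h1 : Y.erase k ⊆ E := by
        intro y hy
        rcases Finset.mem_insert.1 (h (Finset.mem_of_mem_erase hy)) with rfl | h2
        exacts [absurd rfl (Finset.ne_of_mem_erase hy), h2]
      have := Dominated.add (ih h1) (fun z hz => hk z (h1 hz)) hk le_rfl
      rwa [Finset.insert_erase hY] at this
    · refine .skip (ih fun y hy => ?_) hk
      rcases Finset.mem_insert.1 (h hy) with rfl | h2
      exacts [absurd hy hY, h2]

theorem singleton_left {X : Finset ℕ+} {x y : ℕ+} (hx : x ∈ X) (hxy : x ≤ y) :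
    Dominated {y} X := by
  induction X using Finset.induction_on_max with
  | empty => simp at hx
  | insert k E hk ih =>
    rcases Finset.mem_insert.1 hx with rfl | hx
    · simpa using Dominated.add (.empty_left E) (y := y) (by simp) hk hxy
    · exact .skip (ih hx) hk

/-- Inversion: `x` and `X` are recovered from `insert x X` as its maximum and the rest, so either
`x` is skipped or it is matched with the maximum of `Y`. -/
theorem of_insert_right {Y X : Finset ℕ+} {x : ℕ+} (h : Dominated Y (insert x X))
    (hX : ∀ z ∈ X, z < x) :
    Dominated Y X ∨ ∃ Y₀ y, Y = insert y Y₀ ∧ (∀ z ∈ Y₀, z < y) ∧ x ≤ y ∧ Dominated Y₀ X := by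
  generalize hW : insert x X = W at h
  have key : ∀ {X' : Finset ℕ+} {x' : ℕ+}, (∀ z ∈ X', z < x') → insert x X = insert x' X' →
      x = x' ∧ X = X' := by
    intro X' x' hX' he
    have h1 : x = x' := by
      rcases Finset.mem_insert.1 (he ▸ Finset.mem_insert_self x X) with h | h
      · exact h
      · rcases Finset.mem_insert.1 (he.symm ▸ Finset.mem_insert_self x' X') with h' | h'
        · exact h'.symm
        · exact absurd (hX _ h') (not_lt.2 (hX' _ h).le)
    subst h1
    refine ⟨rfl, ?_⟩
    rw [← Finset.erase_insert (notMem_of_forall_lt hX), he,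
      Finset.erase_insert (notMem_of_forall_lt hX')]
  cases h with
  | empty => exact absurd hW (Finset.insert_ne_empty _ _)
  | skip h hX' =>
    obtain ⟨rfl, rfl⟩ := key hX' hW
    exact Or.inl h
  | add h hY hX' hxy =>
    obtain ⟨rfl, rfl⟩ := key hX' hW
    exact Or.inr ⟨_, _, rfl, hY, hxy, h⟩

end Dominated

/-- Hereditary and spreading families containing all singletons. -/
structure IsRegular (F : Set (Finset ℕ+)) : Prop where
  singleton_mem : ∀ n, {n} ∈ F
  of_dominated : ∀ Y X, Dominated Y X → X ∈ F → Y ∈ F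

theorem IsRegular.isInitialClosed {F : Set (Finset ℕ+)} (h : IsRegular F) : IsInitialClosed F where
  empty_mem := h.of_dominated _ _ (.empty_left _) (h.singleton_mem 1)
  singleton_mem := h.singleton_mem
  of_insert E _ hk hE := h.of_dominated _ _ (.skip (.refl E) hk) hE

/-- `X` is the union of successive members of `G`, with set of minima `P` and last piece `B`. -/
inductive Decomposes (G : Set (Finset ℕ+)) : Finset ℕ+ → Finset ℕ+ → Finset ℕ+ → Prop
  | empty : Decomposes G ∅ ∅ ∅
  | extend {X P B : Finset ℕ+} {x : ℕ+} (h : Decomposes G X P B) (hX : ∀ z ∈ X, z < x)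
      (hB : B.Nonempty) (hm : insert x B ∈ G) : Decomposes G (insert x X) P (insert x B)
  | start {X P B : Finset ℕ+} {x : ℕ+} (h : Decomposes G X P B) (hX : ∀ z ∈ X, z < x) :
      Decomposes G (insert x X) (insert x P) {x}

namespace Decomposes

variable {G : Set (Finset ℕ+)}

theorem subset {X P B : Finset ℕ+} (h : Decomposes G X P B) : P ⊆ X ∧ B ⊆ X := by
  induction h with
  | empty => simp
  | extend h hX hB hm ih =>
    exact ⟨ih.1.trans (Finset.subset_insert _ _), Finset.insert_subset_insert _ ih.2⟩
  | start h hX ih =>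
    exact ⟨Finset.insert_subset_insert _ ih.1, by simp⟩

theorem nonempty_of_nonempty {X P B : Finset ℕ+} (h : Decomposes G X P B) (hB : B.Nonempty) :
    P.Nonempty := by
  induction h with
  | empty => exact hB
  | extend h hX hB' hm ih => exact ih hB'
  | start h hX ih => simp

theorem union_greedy (hG : IsInitialClosed G) {X P B C : Finset ℕ+} (h : Decomposes G X P B)
    (hC : C.Nonempty) (hXC : ∀ x ∈ X, ∀ y ∈ C, x < y) :
    Decomposes G (X ∪ C) (P ∪ blockMins G C) (lastBlock G C) := by
  induction C using Finset.induction_on_max with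
  | empty => exact absurd hC (by simp)
  | insert k C hk ih =>
    have hlt : ∀ z ∈ X ∪ C, z < k := fun z hz => by
      rcases Finset.mem_union.1 hz with hz | hz
      exacts [hXC z hz k (by simp), hk z hz]
    rcases C.eq_empty_or_nonempty with rfl | hC'
    · have := Decomposes.start (x := k) h fun z hz => hXC z hz k (by simp)
      simpa [blockMins_singleton hG, lastBlock_singleton hG, Finset.union_comm] using this
    · have ih' := ih hC' fun x hx y hy => hXC x hx y (Finset.mem_insert_of_mem hy)
      rw [Finset.union_insert]
      rcases block_step hG hk with h1 | h1
      · rw [h1.2.2.1, h1.2.2.2]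
        exact ih'.extend hlt (lastBlock_nonempty hG hC') h1.2.1
      · rw [h1.2.1, h1.2.2, Finset.union_insert]
        exact ih'.start hlt

/-- The sets `A i` need not belong to `G`: each is cut greedily, restarting at its minimum. This
generality serves `blockMins_mem_of_mem_one_add`, where they come from a larger family. -/
theorem biUnion_greedy (hG : IsInitialClosed G) {m : ℕ} (A : Fin m → Finset ℕ+)
    (hA : IsSuccessive A) :
    ∃ B, Decomposes G (Finset.univ.biUnion A)
      (Finset.univ.biUnion fun i => blockMins G (A i)) B := by
  induction m with
  | zero => exact ⟨∅, by simpa using Decomposes.empty⟩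
  | succ m ih =>
    obtain ⟨B, hB⟩ := ih (fun i => A i.castSucc) ⟨fun i => hA.1 _, fun i j hij => hA.2 _ _
      (by simpa using hij)⟩
    have := hB.union_greedy hG (hA.1 (Fin.last m)) (fun x hx y hy => ?_)
    · refine ⟨lastBlock G (A (Fin.last m)), ?_⟩
      convert this using 1
      · ext x
        simp [Fin.exists_fin_succ']
      · ext x
        simp [Fin.exists_fin_succ']
    · obtain ⟨i, -, hi⟩ := Finset.mem_biUnion.1 hx
      exact hA.2 _ _ (Fin.castSucc_lt_last i) x hi y hy

/-- The greedy decomposition has the fewest blocks. -/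
theorem dominated_blockMins (hG : IsRegular G) {X P B : Finset ℕ+} (h : Decomposes G X P B) :
    ∀ {Y : Finset ℕ+}, Dominated Y X →
      (∃ P₀ p, P = insert p P₀ ∧ (∀ z ∈ P₀, z < p) ∧ Dominated (blockMins G Y) P₀) ∨
      (Dominated (blockMins G Y) P ∧ Dominated (lastBlock G Y) B) := by
  -- Invariant: either `Y` has a block in reserve (its minima are dominated by `P` without its
  -- maximum), or its last block is dominated by `B` and so, by regularity, can be prolonged
  -- whenever `B` can.
  have hG' := hG.isInitialClosed
  induction h with
  | empty =>
    intro Y hY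
    have h0 : Y = ∅ := by simpa using hY.card_le
    subst h0
    right
    simp [lastBlock_empty hG', Dominated.empty]
  | @extend X P B x h hX hB hm ih =>
    intro Y hY
    rcases hY.of_insert_right hX with h1 | ⟨Y₀, y, rfl, hlt, hxy, h1⟩
    · rcases ih h1 with h2 | h2
      · exact Or.inl h2
      · exact Or.inr ⟨h2.1, .skip h2.2 fun z hz => hX z (h.subset.2 hz)⟩
    · rcases ih h1 with ⟨P₀, p, rfl, hp, h2⟩ | h2
      · rcases block_step hG' hlt with h3 | h3
        · exact Or.inl ⟨P₀, p, rfl, hp, by rwa [h3.2.2.2]⟩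
        · right
          rw [h3.2.1, h3.2.2]
          -- The reserve is spent: the new minimum `y` is matched with the spare maximum `p`.
          refine ⟨.add h2 (blockMins_lt hlt) hp
            ((hX p (h.subset.1 (Finset.mem_insert_self _ _))).le.trans hxy), ?_⟩
          have := Dominated.add (.empty_left B) (y := y) (x := x) (by simp)
            (fun z hz => hX z (h.subset.2 hz)) hxy
          simpa using this
      · right
        have h4 : Dominated (insert y (lastBlock G Y₀)) (insert x B) :=
          .add h2.2 (lastBlock_lt hG' hlt) (fun z hz => hX z (h.subset.2 hz)) hxy
        rcases block_step hG' hlt with h3 | ⟨h3 | h3, h5, h6⟩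
        · rw [h3.2.2.1, h3.2.2.2]
          exact ⟨h2.1, h4⟩
        · subst h3
          rw [h5, h6]
          obtain ⟨p, hp⟩ := h.nonempty_of_nonempty hB
          refine ⟨?_, ?_⟩
          · simpa using Dominated.singleton_left hp ((hX p (h.subset.1 hp)).le.trans hxy)
          · exact .singleton_left (Finset.mem_insert_self _ _) hxy
        · exact absurd (hG.of_dominated _ _ h4 hm) h3
  | @start X P B x h hX ih =>
    intro Y hY
    have hP : ∀ z ∈ P, z < x := fun z hz => hX z (h.subset.1 hz)
    rcases hY.of_insert_right hX with h1 | ⟨Y₀, y, rfl, hlt, hxy, h1⟩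
    · left
      refine ⟨P, x, rfl, hP, ?_⟩
      rcases ih h1 with ⟨P₀, p, rfl, hp, h2⟩ | h2
      exacts [.skip h2 hp, h2.1]
    · rcases block_step hG' hlt with h3 | h3
      · left
        refine ⟨P, x, rfl, hP, ?_⟩
        rw [h3.2.2.2]
        rcases ih h1 with ⟨P₀, p, rfl, hp, h2⟩ | h2
        exacts [.skip h2 hp, h2.1]
      · rw [h3.2.1, h3.2.2]
        rcases ih h1 with ⟨P₀, p, rfl, hp, h2⟩ | h2
        · left
          exact ⟨insert p P₀, x, rfl, hP, .add h2 (blockMins_lt hlt) hp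
            ((hP p (Finset.mem_insert_self _ _)).le.trans hxy)⟩
        · right
          refine ⟨.add h2.1 (blockMins_lt hlt) hP hxy, ?_⟩
          simpa using Dominated.add .empty (y := y) (x := x) (by simp) (by simp) hxy

end Decomposes

/-! ### Convolutions `F[G]` in terms of greedy block minima. -/

section Convolution

variable {F G : Set (Finset ℕ+)}

theorem blockMins_of_mem (hG : IsInitialClosed G) {E : Finset ℕ+} (hE : E.Nonempty)
    (hm : E ∈ G) : blockMins G E = {minElt E} := by
  induction E using Finset.induction_on_max with
  | empty => exact absurd hE (by simp)
  | insert k E hk ih =>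
    have hE' := hG.of_insert E k hk hm
    rcases E.eq_empty_or_nonempty with rfl | hne
    · simp [blockMins_singleton hG]
    rcases block_step hG hk with h1 | ⟨h1 | h1, -⟩
    · rw [h1.2.2.2, minElt_insert hk hne, ih hne hE']
    · exact absurd h1 hne.ne_empty
    · rw [lastBlock_of_mem hE'] at h1
      exact absurd hm h1

theorem dominated_biUnion_blockMins (hG : IsRegular G) {m : ℕ} (A : Fin m → Finset ℕ+)
    (hA : IsSuccessive A) {Y : Finset ℕ+} (hY : Dominated Y (Finset.univ.biUnion A)) :
    Dominated (blockMins G Y) (Finset.univ.biUnion fun i => blockMins G (A i)) := by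
  obtain ⟨B, hB⟩ := Decomposes.biUnion_greedy hG.isInitialClosed A hA
  rcases hB.dominated_blockMins hG hY with ⟨P₀, p, hP, hp, h⟩ | h
  · rw [hP]; exact .skip h hp
  · exact h.1

theorem dominated_image_minElt (hG : IsRegular G) {m : ℕ} (A : Fin m → Finset ℕ+)
    (hA : IsSuccessive A) (hm : ∀ i, A i ∈ G) {Y : Finset ℕ+}
    (hY : Dominated Y (Finset.univ.biUnion A)) :
    Dominated (blockMins G Y) (Finset.univ.image fun i => minElt (A i)) := by
  have h := dominated_biUnion_blockMins hG A hA hY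
  simp only [blockMins_of_mem hG.isInitialClosed (hA.1 _) (hm _)] at h
  rwa [Finset.biUnion_singleton] at h

/-- If any decomposition into members of `G` has minima in `F`, so does the greedy one, since its
minima are dominated by those of the former. -/
theorem mem_conv_iff (hF : IsRegular F) (hG : IsRegular G) {X : Finset ℕ+} :
    X ∈ conv F G ↔ blockMins G X ∈ F := by
  constructor
  · rintro (rfl | ⟨m, A, hA, hm, hF', rfl⟩)
    · simpa using hF.isInitialClosed.empty_mem
    · exact hF.of_dominated _ _ (dominated_image_minElt hG A hA hm (.refl _)) hF'
  · intro h
    obtain ⟨A, h1, h2, h3, h4⟩ := exists_greedy_decomposition hG.isInitialClosed X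
    exact Or.inr ⟨_, A, h1, h2, by rwa [h3], h4⟩

theorem isInitialClosed_conv (hF : IsRegular F) (hG : IsRegular G) :
    IsInitialClosed (conv F G) where
  empty_mem := Or.inl rfl
  singleton_mem n := by
    rw [mem_conv_iff hF hG, blockMins_singleton hG.isInitialClosed]
    exact hF.singleton_mem n
  of_insert E k hk h := by
    rw [mem_conv_iff hF hG] at h ⊢
    rcases block_step hG.isInitialClosed hk with h1 | h1
    · rwa [h1.2.2.2] at h
    · rw [h1.2.2] at h
      exact hF.isInitialClosed.of_insert _ _ (blockMins_lt hk) h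

/-- Passing to block minima commutes with taking last blocks. -/
theorem blockMins_lastBlock_conv (hF : IsRegular F) (hG : IsRegular G) (E : Finset ℕ+) :
    blockMins G (lastBlock (conv F G) E) = lastBlock F (blockMins G E) ∧
      lastBlock G (lastBlock (conv F G) E) = lastBlock G E := by
  classical
  have hC := isInitialClosed_conv hF hG
  have hF' := hF.isInitialClosed
  have hG' := hG.isInitialClosed
  induction E using Finset.induction_on_max with
  | empty => simp [lastBlock_empty, hC, hF', hG']
  | insert k E hk ih =>
    obtain ⟨i1, i2⟩ := ih
    have hk' := lastBlock_lt hC hk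
    rw [lastBlock_insert hC hk, mem_conv_iff hF hG]
    rcases E.eq_empty_or_nonempty with rfl | hE
    · have h1 : insert k (∅ : Finset ℕ+) = {k} := rfl
      simp only [lastBlock_empty hC, h1, ite_self, blockMins_singleton hG',
        lastBlock_singleton hF', and_self]
    have hE' := lastBlock_nonempty hC hE
    -- `E` and its last `conv`-block have the same last `G`-block by `i2`, so `k` prolongs it in
    -- both or opens a new one in both; only in the latter case does `F` decide whether a new
    -- `conv`-block begins.
    rcases block_step hG' hk with h1 | ⟨h1 | h1, h2, h3⟩
    · rcases block_step hG' hk' with h4 | ⟨h4 | h4, h5, h6⟩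
      · have h7 : blockMins G (insert k (lastBlock (conv F G) E)) ∈ F := by
          rw [h4.2.2.2, i1]; exact lastBlock_mem hF' _
        rw [if_pos h7, h4.2.2.1, h4.2.2.2, h1.2.2.1, h1.2.2.2]
        exact ⟨i1, by rw [i2]⟩
      · exact absurd h4 hE'.ne_empty
      · rw [i2] at h4; exact absurd h1.2.1 h4
    · exact absurd h1 hE.ne_empty
    · rcases block_step hG' hk' with h4 | ⟨-, h5, h6⟩
      · rw [i2] at h4; exact absurd h4.2.1 h1
      · rw [h6, h3, h2, lastBlock_insert hF' (blockMins_lt hk), i1]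
        split_ifs with h7
        · exact ⟨by rw [h6, i1], h5⟩
        · exact ⟨blockMins_singleton hG' k, lastBlock_singleton hG' k⟩

end Convolution

/-! ### Schreier families -/

theorem schreier_zero (c : LimitSequences) : schreier c 0 = {E | E = ∅ ∨ ∃ n, E = {n}} :=
  Ordinal.limitRecOn_zero ..

theorem schreier_add_one (c : LimitSequences) (ξ : Ordinal.{0}) :
    schreier c (ξ + 1) = {E | E = ∅ ∨ ∃ (m : ℕ) (A : Fin m → Finset ℕ+), IsSuccessive A ∧
      (∀ i, A i ∈ schreier c ξ) ∧ E = Finset.univ.biUnion A ∧ ∀ x ∈ E, m ≤ (x : ℕ)} :=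
  Ordinal.limitRecOn_add_one ..

theorem schreier_limit (c : LimitSequences) {ξ : Ordinal.{0}} (hξ : Order.IsSuccLimit ξ) :
    schreier c ξ = {E | E = ∅ ∨ ∃ n : ℕ+, (∀ x ∈ E, n ≤ x) ∧ E ∈ schreier c (c.seq ξ n + 1)} :=
  Ordinal.limitRecOn_limit _ _ _ _ hξ

theorem mem_schreier_zero {c : LimitSequences} {E : Finset ℕ+} :
    E ∈ schreier c 0 ↔ E.card ≤ 1 := by
  rw [schreier_zero, Finset.card_le_one_iff_subset_singleton]
  simp only [Finset.subset_singleton_iff]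
  constructor
  · rintro (rfl | ⟨n, rfl⟩)
    exacts [⟨1, Or.inl rfl⟩, ⟨n, Or.inr rfl⟩]
  · rintro ⟨n, h | h⟩
    exacts [Or.inl h, Or.inr ⟨n, h⟩]

theorem mem_schreier_add_one_of_isRegular {c : LimitSequences} {ξ : Ordinal.{0}}
    (hG : IsRegular (schreier c ξ)) {E : Finset ℕ+} :
    E ∈ schreier c (ξ + 1) ↔ ∀ x ∈ E, (blockMins (schreier c ξ) E).card ≤ (x : ℕ) := by
  rw [schreier_add_one]
  constructor
  · rintro (rfl | ⟨m, A, hA, hm, rfl, hx⟩) x hxE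
    · simp at hxE
    · refine ((dominated_image_minElt hG A hA hm (.refl _)).card_le.trans
        Finset.card_image_le).trans ?_
      simpa using hx x hxE
  · intro h
    obtain ⟨A, h1, h2, -, h4⟩ := exists_greedy_decomposition hG.isInitialClosed E
    exact Or.inr ⟨_, A, h1, h2, h4, h⟩

/-- Successor step: a dominated set has no more greedy blocks than the given set has pieces, and
each of its elements lies above an element of that set, so the bound by the minimum survives. -/
theorem isRegular_schreier (c : LimitSequences) (ξ : Ordinal.{0}) : IsRegular (schreier c ξ) := by
  induction ξ using Ordinal.limitRecOn with
  | zero =>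
    refine ⟨fun n => by simp [mem_schreier_zero], fun Y X h hX => ?_⟩
    rw [mem_schreier_zero] at hX ⊢
    exact h.card_le.trans hX
  | add_one ξ ih =>
    refine ⟨fun n => ?_, fun Y X h hX => ?_⟩
    · rw [mem_schreier_add_one_of_isRegular ih, blockMins_singleton ih.isInitialClosed]
      intro x hx
      rw [Finset.card_singleton]
      exact x.pos
    · rw [mem_schreier_add_one_of_isRegular ih]
      rw [schreier_add_one] at hX
      intro y hy
      obtain ⟨x, hx, hxy⟩ := h.exists_le y hy
      rcases hX with rfl | ⟨m, A, hA, hm, rfl, hX⟩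
      · simp at hx
      · calc _ ≤ _ := (dominated_image_minElt ih A hA hm h).card_le
          _ ≤ _ := Finset.card_image_le
          _ ≤ (x : ℕ) := by simpa using hX x hx
          _ ≤ y := by exact_mod_cast hxy
  | limit ξ hξ ih =>
    refine ⟨fun n => ?_, fun Y X h hX => ?_⟩
    · rw [schreier_limit c hξ]
      exact Or.inr ⟨n, by simp, (ih _ (hξ.add_one_lt (c.lt ξ n hξ))).singleton_mem n⟩
    · rw [schreier_limit c hξ] at hX ⊢
      rcases hX with rfl | ⟨n, hn, hX⟩
      · left
        simpa using h.card_le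
      · refine Or.inr ⟨n, fun y hy => ?_,
          (ih _ (hξ.add_one_lt (c.lt ξ n hξ))).of_dominated _ _ h hX⟩
        obtain ⟨x, hx, hxy⟩ := h.exists_le y hy
        exact (hn x hx).trans hxy

theorem isInitialClosed_schreier (c : LimitSequences) (ξ : Ordinal.{0}) :
    IsInitialClosed (schreier c ξ) := (isRegular_schreier c ξ).isInitialClosed

theorem mem_schreier_add_one {c : LimitSequences} {ξ : Ordinal.{0}} {E : Finset ℕ+} :
    E ∈ schreier c (ξ + 1) ↔ ∀ x ∈ E, (blockMins (schreier c ξ) E).card ≤ (x : ℕ) :=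
  mem_schreier_add_one_of_isRegular (isRegular_schreier c ξ)

theorem schreier_subset_add_one (c : LimitSequences) (ξ : Ordinal.{0}) :
    schreier c ξ ⊆ schreier c (ξ + 1) := by
  intro E hE
  rw [schreier_add_one]
  rcases E.eq_empty_or_nonempty with rfl | h
  · exact Or.inl rfl
  · refine Or.inr ⟨1, fun _ => E, ⟨fun _ => h, fun i j hij => ?_⟩, fun _ => hE, by simp,
      fun x _ => x.2⟩
    exact absurd hij (by simp [Subsingleton.elim i j])

/-- For characteristic sequences, a non-empty set belongs to the family of a limit ordinal exactly
if it belongs to the family determined by its minimum. -/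
theorem mem_schreier_limit {c : LimitSequences} (hc : c.IsCharacteristic) {ξ : Ordinal.{0}}
    (hξ : Order.IsSuccLimit ξ) (hξ₁ : ξ < ω₁) {E : Finset ℕ+} (hE : E.Nonempty) :
    E ∈ schreier c ξ ↔ E ∈ schreier c (c.seq ξ (minElt E) + 1) := by
  rw [schreier_limit c hξ]
  constructor
  · rintro (rfl | ⟨n, hn, h⟩)
    · simp at hE
    · have hmono : Monotone fun n : ℕ+ => schreier c (c.seq ξ n + 1) := by
        refine monotone_of_le_add_one fun n _ => ?_
        exact ((hc ξ hξ₁ hξ).2.2 n).trans (schreier_subset_add_one c _)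
      exact hmono (hn _ (minElt_mem hE)) h
  · exact fun h => Or.inr ⟨_, fun x hx => minElt_le hx, h⟩

theorem mem_schreier_one {c : LimitSequences} {E : Finset ℕ+} :
    E ∈ schreier c 1 ↔ ∀ x ∈ E, E.card ≤ (x : ℕ) := by
  have h0 := isInitialClosed_schreier c 0
  have key : ∀ E : Finset ℕ+, blockMins (schreier c 0) E = E := fun E => by
    induction E using Finset.induction_on_max with
    | empty => simp
    | insert k E hk ih =>
      rcases block_step h0 hk with h1 | h1
      · have h2 := mem_schreier_zero.1 h1.2.1
        rw [Finset.card_insert_of_notMem (notMem_of_forall_lt (lastBlock_lt h0 hk))] at h2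
        have := (lastBlock_nonempty h0 h1.1).card_pos
        omega
      · rw [h1.2.2, ih]
  rw [← zero_add (1 : Ordinal), mem_schreier_add_one, key]

/-- The family `S_{1+ζ}` is contained in `S_ζ[S_1]`. -/
theorem blockMins_mem_of_mem_one_add {c : LimitSequences} (ζ : Ordinal.{0}) {E : Finset ℕ+}
    (hE : E ∈ schreier c (1 + ζ)) : blockMins (schreier c 1) E ∈ schreier c ζ := by
  have h1 := isRegular_schreier c 1
  rcases lt_or_ge ζ ω with hζ | hζ
  · obtain ⟨n, rfl⟩ := Ordinal.lt_omega0.1 hζ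
    clear hζ
    induction n generalizing E with
    | zero =>
      rw [Nat.cast_zero, add_zero] at hE
      rw [Nat.cast_zero]
      rcases E.eq_empty_or_nonempty with rfl | hne
      · simpa using (isInitialClosed_schreier c 0).empty_mem
      · rw [blockMins_of_mem h1.isInitialClosed hne hE]
        exact (isInitialClosed_schreier c 0).singleton_mem _
    | succ n ih =>
      rw [Nat.cast_add_one, ← add_assoc, schreier_add_one] at hE
      rw [Nat.cast_add_one]
      rcases hE with rfl | ⟨m, A, hA, hm, rfl, hx⟩
      · simpa using (isInitialClosed_schreier c _).empty_mem
      -- Restarting the S_1-blocks at every `A i` gives a dominating set of minima, which is a union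
      -- of `m` successive members of the previous family.
      refine (isRegular_schreier c _).of_dominated _ _
        (dominated_biUnion_blockMins h1 A hA (.refl _)) ?_
      rw [schreier_add_one]
      refine Or.inr ⟨m, fun i => blockMins (schreier c 1) (A i),
        ⟨fun i => blockMins_nonempty h1.isInitialClosed (hA.1 i), fun i j hij x hx y hy =>
          hA.2 i j hij x (blockMins_subset _ hx) y (blockMins_subset _ hy)⟩,
        fun i => ih (hm i), rfl, fun x hx' => hx x ?_⟩
      obtain ⟨i, hi, hxi⟩ := Finset.mem_biUnion.1 hx'
      exact Finset.mem_biUnion.2 ⟨i, hi, blockMins_subset _ hxi⟩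
  · rw [Ordinal.one_add_of_omega0_le hζ] at hE
    exact (isRegular_schreier c ζ).of_dominated _ _ (.of_subset (blockMins_subset E)) hE

/-! ### Weights -/

section Weights

variable (c : LimitSequences)

theorem avgWeight_zero : avgWeight c 0 = fun _ => 1 :=
  Ordinal.limitRecOn_zero ..

theorem avgWeight_add_one (ξ : Ordinal.{0}) (E : Finset ℕ+) :
    avgWeight c (ξ + 1) E = avgWeight c ξ (lastBlock (schreier c ξ)
      (lastBlock (schreier c (ξ + 1)) E)) / (minElt (lastBlock (schreier c (ξ + 1)) E) : ℝ) :=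
  congrFun (Ordinal.limitRecOn_add_one (motive := fun _ => Finset ℕ+ → ℝ) ..) E

theorem avgWeight_limit {ξ : Ordinal.{0}} (hξ : Order.IsSuccLimit ξ) (E : Finset ℕ+) :
    avgWeight c ξ E = avgWeight c (c.seq ξ (minElt (lastBlock (schreier c ξ) E)) + 1)
      (lastBlock (schreier c ξ) E) :=
  congrFun (Ordinal.limitRecOn_limit (motive := fun _ => Finset ℕ+ → ℝ) _ _ _ _ hξ) E

theorem sqrtWeight_zero (ξ : Ordinal.{0}) : sqrtWeight c ξ 0 = fun _ => 1 :=
  Ordinal.limitRecOn_zero ..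

theorem sqrtWeight_add_one (ξ ζ : Ordinal.{0}) (E : Finset ℕ+) :
    sqrtWeight c ξ (ζ + 1) E = sqrtWeight c ξ ζ (lastBlock (conv (schreier c ζ) (schreier c ξ))
      (lastBlock (conv (schreier c (ζ + 1)) (schreier c ξ)) E)) /
        √(minElt (lastBlock (conv (schreier c (ζ + 1)) (schreier c ξ)) E) : ℝ) :=
  congrFun (Ordinal.limitRecOn_add_one (motive := fun _ => Finset ℕ+ → ℝ) ..) E

theorem sqrtWeight_limit (ξ : Ordinal.{0}) {ζ : Ordinal.{0}} (hζ : Order.IsSuccLimit ζ)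
    (E : Finset ℕ+) :
    sqrtWeight c ξ ζ E = sqrtWeight c ξ
      (c.seq ζ (minElt (lastBlock (conv (schreier c ζ) (schreier c ξ)) E)) + 1)
      (lastBlock (conv (schreier c ζ) (schreier c ξ)) E) :=
  congrFun (Ordinal.limitRecOn_limit (motive := fun _ => Finset ℕ+ → ℝ) _ _ _ _ hζ) E

theorem avgWeight_nonneg (ξ : Ordinal.{0}) (E : Finset ℕ+) : 0 ≤ avgWeight c ξ E := by
  induction ξ using Ordinal.limitRecOn generalizing E with
  | zero => simp [avgWeight_zero]
  | add_one ξ ih => rw [avgWeight_add_one]; exact div_nonneg (ih _) (by positivity)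
  | limit ξ hξ ih => rw [avgWeight_limit c hξ]; exact ih _ (hξ.add_one_lt (c.lt ξ _ hξ)) _

theorem avgWeight_lastBlock (ξ : Ordinal.{0}) (E : Finset ℕ+) :
    avgWeight c ξ (lastBlock (schreier c ξ) E) = avgWeight c ξ E := by
  have h := lastBlock_lastBlock (isInitialClosed_schreier c ξ) E
  induction ξ using Ordinal.limitRecOn with
  | zero => simp [avgWeight_zero]
  | add_one ξ ih => rw [avgWeight_add_one, avgWeight_add_one, h]
  | limit ξ hξ ih => rw [avgWeight_limit c hξ, avgWeight_limit c hξ, h]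

/-- The square-root weights are square roots of averaging weights of sets of block minima. -/
theorem sqrtWeight_eq (ξ ζ : Ordinal.{0}) (E : Finset ℕ+) :
    sqrtWeight c ξ ζ E = √(avgWeight c ζ (blockMins (schreier c ξ) E)) := by
  have hξ := isRegular_schreier c ξ
  have key := fun ζ E => (blockMins_lastBlock_conv (isRegular_schreier c ζ) hξ E).1
  induction ζ using Ordinal.limitRecOn generalizing E with
  | zero => simp [sqrtWeight_zero, avgWeight_zero]
  | add_one ζ ih =>
    -- A set and its block minima have the same minimum, so both recursions divide by matching
    -- quantities.
    rw [sqrtWeight_add_one, avgWeight_add_one, ih, key, key,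
      ← minElt_blockMins hξ.isInitialClosed (lastBlock _ E), key,
      Real.sqrt_div (avgWeight_nonneg c _ _)]
  | limit ζ hζ ih =>
    rw [sqrtWeight_limit c ξ hζ, avgWeight_limit c hζ, ih _ (hζ.add_one_lt (c.lt ζ _ hζ)), key,
      ← minElt_blockMins hξ.isInitialClosed (lastBlock _ E), key]

/-- The sum of the values of `p` at the non-empty initial segments of `E`. -/
def initialSum (p : Finset ℕ+ → ℝ) (E : Finset ℕ+) : ℝ :=
  ∑ x ∈ E, p (E.filter (· ≤ x))

variable {c}

@[simp] theorem initialSum_empty (p : Finset ℕ+ → ℝ) : initialSum p ∅ = 0 := by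
  simp [initialSum]

theorem initialSum_insert (p : Finset ℕ+ → ℝ) {E : Finset ℕ+} {k : ℕ+} (h : ∀ x ∈ E, x < k) :
    initialSum p (insert k E) = initialSum p E + p (insert k E) := by
  rw [initialSum, Finset.sum_insert (notMem_of_forall_lt h), filter_le_insert_self h, add_comm,
    initialSum]
  congr 1
  exact Finset.sum_congr rfl fun x hx => by rw [filter_le_insert h hx]

theorem IsInitialClosed.filter_le_mem {F : Set (Finset ℕ+)} (hF : IsInitialClosed F)
    {E : Finset ℕ+} (hE : E ∈ F) {x : ℕ+} (hx : x ∈ E) : E.filter (· ≤ x) ∈ F := by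
  induction E using Finset.induction_on_max with
  | empty => simp at hx
  | insert k E hk ih =>
    rcases Finset.mem_insert.1 hx with rfl | hx'
    · rwa [filter_le_insert_self hk]
    · rw [filter_le_insert hk hx']
      exact ih (hF.of_insert _ _ hk hE) hx'

theorem minElt_filter_le {E : Finset ℕ+} {x : ℕ+} (hx : x ∈ E) :
    minElt (E.filter (· ≤ x)) = minElt E :=
  minElt_eq (Finset.mem_filter.2 ⟨minElt_mem ⟨x, hx⟩, minElt_le hx⟩)
    fun _ hy => minElt_le (Finset.mem_filter.1 hy).1

/-- If the weights of complete blocks add up to one, then the total weight of a set is determined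
by the number of its blocks and by its last block. -/
theorem initialSum_blocks {G : Set (Finset ℕ+)} (hG : IsInitialClosed G) {p : Finset ℕ+ → ℝ}
    (hp : ∀ E, p (lastBlock G E) = p E)
    (h1 : ∀ E k, E.Nonempty → (∀ x ∈ E, x < k) → E ∈ G → insert k E ∉ G → initialSum p E = 1)
    (w : Finset ℕ+ → ℝ) (E : Finset ℕ+) :
    initialSum (fun A => w (blockMins G A) * p A) E = initialSum w (blockMins G E) -
      w (blockMins G E) * (1 - initialSum p (lastBlock G E)) + if E = ∅ then w ∅ else 0 := by
  -- The last summand matters only for `E = ∅`, where it cancels the correction term `-w ∅`.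
  induction E using Finset.induction_on_max with
  | empty => simp [lastBlock_empty hG]
  | insert k E hk ih =>
    rw [initialSum_insert _ hk, ih, if_neg (Finset.insert_ne_empty _ _), ← hp (insert k E)]
    rcases block_step hG hk with h2 | ⟨h2, h3, h4⟩
    · rw [h2.2.2.1, h2.2.2.2, initialSum_insert p (lastBlock_lt hG hk),
        if_neg h2.1.ne_empty]
      ring
    · have h5 : initialSum p {k} = p {k} := by
        simpa using initialSum_insert p (E := ∅) (k := k) (by simp)
      rw [h3, h4, initialSum_insert _ (blockMins_lt hk), h5]
      rcases E.eq_empty_or_nonempty with rfl | hE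
      · simp [lastBlock_empty hG]; ring
      · rcases h2 with h2 | h2
        · exact absurd h2 hE.ne_empty
        · rw [h1 _ k (lastBlock_nonempty hG hE) (lastBlock_lt hG hk) (lastBlock_mem hG E) h2,
            if_neg hE.ne_empty]
          ring

/-- The averaging weights add up to one over complete blocks. -/
theorem initialSum_avgWeight (hc : c.IsCharacteristic) {ξ : Ordinal.{0}} (hξ₁ : ξ < ω₁)
    {E : Finset ℕ+} {k : ℕ+} (hE : E.Nonempty) (hk : ∀ x ∈ E, x < k) (hm : E ∈ schreier c ξ)
    (hm' : insert k E ∉ schreier c ξ) : initialSum (avgWeight c ξ) E = 1 := by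
  induction ξ using Ordinal.limitRecOn generalizing E k with
  | zero =>
    have h1 := mem_schreier_zero.1 hm
    have h2 := hE.card_pos
    simp only [initialSum, avgWeight_zero, Finset.sum_const, nsmul_eq_mul, mul_one]
    norm_cast
    omega
  | add_one ξ ih =>
    have hξ' : ξ < ω₁ := lt_of_le_of_lt (le_self_add) hξ₁
    have hG := isInitialClosed_schreier c ξ
    have hG1 := isInitialClosed_schreier c (ξ + 1)
    have h1 : initialSum (avgWeight c (ξ + 1)) E =
        initialSum (avgWeight c ξ) E / (minElt E : ℝ) := by
      rw [initialSum, initialSum, Finset.sum_div]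
      refine Finset.sum_congr rfl fun x hx => ?_
      rw [avgWeight_add_one, lastBlock_of_mem (hG1.filter_le_mem hm hx), minElt_filter_le hx,
        avgWeight_lastBlock]
    have h2 := initialSum_blocks hG (avgWeight_lastBlock c ξ)
      (fun E k h1 h2 h3 h4 => ih hξ' h1 h2 h3 h4) (fun _ => 1) E
    simp only [one_mul, if_neg hE.ne_empty, add_zero] at h2
    rw [mem_schreier_add_one] at hm hm'
    push Not at hm'
    obtain ⟨x, hx, hx'⟩ := hm'
    have hmin : (minElt E : ℕ) ≤ x := by
      have : minElt E ≤ x := by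
        rw [← minElt_insert hk hE]; exact minElt_le hx
      exact_mod_cast this
    have h3 := hm _ (minElt_mem hE)
    -- The bound can fail only if `k` opens a new block. Hence the last block of `E` is complete and
    -- `E` has exactly `minElt E` blocks, each contributing 1 / `minElt E`.
    rcases block_step hG hk with h4 | ⟨h4 | h4, h5, h6⟩
    · rw [h4.2.2.2] at hx'
      omega
    · exact absurd h4 hE.ne_empty
    · rw [h6, Finset.card_insert_of_notMem (notMem_of_forall_lt (blockMins_lt hk))] at hx'
      rw [ih hξ' (lastBlock_nonempty hG hE) (lastBlock_lt hG hk) (lastBlock_mem hG E) h4, sub_self,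
        sub_zero] at h2
      have h7 : (blockMins (schreier c ξ) E).card = (minElt E : ℕ) := by omega
      have h8 : (minElt E : ℝ) ≠ 0 := by positivity
      rw [h1, show initialSum (avgWeight c ξ) E = (minElt E : ℝ) from ?_, div_self h8]
      rw [h2, initialSum, Finset.sum_const, h7]
      simp
  | limit ξ hξ ih =>
    have h0 := c.lt ξ (minElt E) hξ
    have hlt := hξ.add_one_lt h0
    have hmin := minElt_insert hk hE
    rw [← ih _ hlt (hlt.trans hξ₁) hE hk ((mem_schreier_limit hc hξ hξ₁ hE).1 hm) fun h =>
      hm' ((mem_schreier_limit hc hξ hξ₁ (Finset.insert_nonempty _ _)).2 (by rwa [hmin]))]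
    refine Finset.sum_congr rfl fun x hx => ?_
    rw [avgWeight_limit c hξ, lastBlock_of_mem ((isInitialClosed_schreier c ξ).filter_le_mem hm hx),
      minElt_filter_le hx]

/-- The weights of the combinations `𝔼^{(2)}` satisfy `∑ q² p = 1` over complete blocks. -/
theorem initialSum_avgWeight_mul (hc : c.IsCharacteristic) {ξ ζ : Ordinal.{0}} (hξ₁ : ξ < ω₁)
    (hζ₁ : ζ < ω₁) {E : Finset ℕ+} {k : ℕ+} (hE : E.Nonempty) (hk : ∀ x ∈ E, x < k)
    (hm : E ∈ conv (schreier c ζ) (schreier c ξ))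
    (hm' : insert k E ∉ conv (schreier c ζ) (schreier c ξ)) :
    initialSum (fun A => avgWeight c ζ (blockMins (schreier c ξ) A) * avgWeight c ξ A) E = 1 ∧
      initialSum (avgWeight c ζ) (blockMins (schreier c ξ) E) = 1 := by
  have hG := isInitialClosed_schreier c ξ
  rw [mem_conv_iff (isRegular_schreier c ζ) (isRegular_schreier c ξ)] at hm hm'
  rw [initialSum_blocks hG (avgWeight_lastBlock c ξ)
    (fun E k h1 h2 h3 h4 => initialSum_avgWeight hc hξ₁ h1 h2 h3 h4), if_neg hE.ne_empty]
  rcases block_step hG hk with h4 | ⟨h4 | h4, h5, h6⟩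
  · rw [h4.2.2.2] at hm'; exact absurd hm hm'
  · exact absurd h4 hE.ne_empty
  · rw [h6] at hm'
    rw [initialSum_avgWeight hc hξ₁ (lastBlock_nonempty hG hE) (lastBlock_lt hG hk)
      (lastBlock_mem hG E) h4, initialSum_avgWeight hc hζ₁ (blockMins_nonempty hG hE)
      (blockMins_lt hk) hm hm']
    simp

end Weights

/-! ### Ranks -/

/-- A function which decreases strictly along proper extensions of members of `F`. -/
def IsRank (F : Set (Finset ℕ+)) (ρ : Finset ℕ+ → Ordinal.{0}) : Prop :=
  ∀ E k, (∀ x ∈ E, x < k) → insert k E ∈ F → ρ (insert k E) < ρ E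

theorem IsRank.lt_empty {F : Set (Finset ℕ+)} {ρ : Finset ℕ+ → Ordinal.{0}} (h : IsRank F ρ)
    (hF : IsInitialClosed F) {E : Finset ℕ+} (hE : E.Nonempty) (hm : E ∈ F) : ρ E < ρ ∅ := by
  induction E using Finset.induction_on_max with
  | empty => exact absurd hE (by simp)
  | insert k E hk ih =>
    rcases E.eq_empty_or_nonempty with rfl | hne
    · exact h _ _ hk hm
    · exact (h _ _ hk hm).trans (ih hne (hF.of_insert _ _ hk hm))

/-- For ξ + 1, a non-empty E has rank ω^ξ · r plus the rank of its last block, where r counts the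
blocks that may still be opened. Opening one lowers r by 1, and a one-element block has rank below
ω^ξ. At a limit, min E selects the rank for ξ_{min E} + 1, whose values stay below ω^ξ on non-empty
members. -/
theorem exists_isRank_schreier {c : LimitSequences} (hc : c.IsCharacteristic) {ξ : Ordinal.{0}}
    (hξ₁ : ξ < ω₁) : ∃ ρ, IsRank (schreier c ξ) ρ ∧ ρ ∅ = ω ^ ξ := by
  classical
  induction ξ using Ordinal.limitRecOn with
  | zero =>
    refine ⟨fun E => if E = ∅ then 1 else 0, fun E k hk hm => ?_, by simp⟩
    rw [mem_schreier_zero, Finset.card_insert_of_notMem (notMem_of_forall_lt hk)] at hm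
    have : E = ∅ := Finset.card_eq_zero.1 (by omega)
    simp [this]
  | add_one ξ ih =>
    obtain ⟨ρ, h1, h2⟩ := ih (lt_of_le_of_lt (le_self_add) hξ₁)
    have hG := isInitialClosed_schreier c ξ
    have hone : ∀ k, ρ {k} < ω ^ ξ := fun k =>
      h2 ▸ h1.lt_empty hG (Finset.singleton_nonempty k) (hG.singleton_mem k)
    refine ⟨fun E => if E = ∅ then ω ^ (ξ + 1) else
      ω ^ ξ * (((minElt E : ℕ) - (blockMins (schreier c ξ) E).card : ℕ) : Ordinal) +
        ρ (lastBlock (schreier c ξ) E), fun E k hk hm => ?_, by simp⟩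
    rw [mem_schreier_add_one] at hm
    have hm2 := hm _ (minElt_mem (Finset.insert_nonempty k E))
    simp only [Finset.insert_ne_empty, if_false]
    rcases E.eq_empty_or_nonempty with rfl | hE
    · simp only [if_true, insert_empty_eq, minElt_singleton, lastBlock_singleton hG]
      rw [Ordinal.opow_add, Ordinal.opow_one]
      calc _ < ω ^ ξ * _ + ω ^ ξ := (add_lt_add_iff_left _).2 (hone k)
        _ = ω ^ ξ * ((_ + 1 : ℕ) : Ordinal) := by rw [Nat.cast_add_one, mul_add, mul_one]
        _ ≤ ω ^ ξ * ω := mul_le_mul_right (Ordinal.natCast_lt_omega0 _).le _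
    rw [if_neg hE.ne_empty]
    rw [minElt_insert hk hE] at hm2 ⊢
    rcases block_step hG hk with h4 | ⟨h4 | h4, h5, h6⟩
    · rw [h4.2.2.1, h4.2.2.2]
      exact (add_lt_add_iff_left _).2 (h1 _ _ (lastBlock_lt hG hk) h4.2.1)
    · exact absurd h4 hE.ne_empty
    · rw [h6, Finset.card_insert_of_notMem (notMem_of_forall_lt (blockMins_lt hk))] at hm2 ⊢
      rw [h5]
      obtain ⟨n, hn⟩ : ∃ n, (minElt E : ℕ) - (blockMins (schreier c ξ) E).card = n + 1 :=
        ⟨(minElt E : ℕ) - (blockMins (schreier c ξ) E).card - 1, by omega⟩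
      rw [show (minElt E : ℕ) - ((blockMins (schreier c ξ) E).card + 1) = n by omega, hn]
      calc _ < ω ^ ξ * _ + ω ^ ξ := (add_lt_add_iff_left _).2 (hone k)
        _ = ω ^ ξ * ((n + 1 : ℕ) : Ordinal) := by rw [Nat.cast_add_one, mul_add, mul_one]
        _ ≤ _ := le_self_add
  | limit ξ hξ ih =>
    have hlt := fun n => hξ.add_one_lt (c.lt ξ n hξ)
    choose ρ h1 h2 using fun n => ih _ (hlt n) ((hlt n).trans hξ₁)
    refine ⟨fun E => if E = ∅ then ω ^ ξ else ρ (minElt E) E, fun E k hk hm => ?_, by simp⟩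
    rw [mem_schreier_limit hc hξ hξ₁ (Finset.insert_nonempty _ _)] at hm
    simp only [Finset.insert_ne_empty, if_false]
    rcases E.eq_empty_or_nonempty with rfl | hE
    · rw [if_pos rfl]
      refine (h1 _ _ _ hk hm).trans ?_
      rw [h2]
      exact (Ordinal.opow_lt_opow_iff_right Ordinal.one_lt_omega0).2 (hlt _)
    · rw [if_neg hE.ne_empty]
      rw [minElt_insert hk hE] at hm ⊢
      exact h1 _ _ _ hk hm

theorem initSeg_add_one (M : ℕ → ℕ+) (n : ℕ) :
    initSeg M (n + 1) = insert (M n) (initSeg M n) := by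
  rw [initSeg, Finset.range_add_one, Finset.image_insert, initSeg]

theorem lt_of_mem_initSeg {M : ℕ → ℕ+} (hM : StrictMono M) (n : ℕ) :
    ∀ x ∈ initSeg M n, x < M n := by
  intro x hx
  obtain ⟨i, hi, rfl⟩ := Finset.mem_image.1 hx
  exact hM (Finset.mem_range.1 hi)

/-- Every infinite set has a finite initial segment which does not belong to `S_ζ[S_ξ]`. -/
theorem exists_initSeg_notMem_conv {c : LimitSequences} (hc : c.IsCharacteristic)
    {ξ ζ : Ordinal.{0}} (hξ₁ : ξ < ω₁) (hζ₁ : ζ < ω₁) {M : ℕ → ℕ+} (hM : StrictMono M) :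
    ∃ n, initSeg M n ∉ conv (schreier c ζ) (schreier c ξ) := by
  by_contra! hcon
  have hF := isRegular_schreier c ζ
  have hG := isRegular_schreier c ξ
  have hG' := hG.isInitialClosed
  obtain ⟨ρ, h1, -⟩ := exists_isRank_schreier hc hξ₁
  obtain ⟨σ, h2, -⟩ := exists_isRank_schreier hc hζ₁
  -- Otherwise the pair (rank of the block minima, rank of the last block) would decrease
  -- lexicographically forever.
  have hwf : WellFounded (Prod.Lex ((· < ·) : Ordinal.{0} → Ordinal.{0} → Prop)
    ((· < ·) : Ordinal.{0} → Ordinal.{0} → Prop)) :=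
    WellFounded.prod_lex Ordinal.lt_wf Ordinal.lt_wf
  refine (RelEmbedding.wellFounded_iff_isEmpty.1 hwf).elim (RelEmbedding.natGT (fun n =>
    (σ (blockMins (schreier c ξ) (initSeg M n)), ρ (lastBlock (schreier c ξ) (initSeg M n))))
    fun n => ?_)
  have hk := lt_of_mem_initSeg hM n
  have hm := (mem_conv_iff hF hG).1 (hcon (n + 1))
  rw [initSeg_add_one] at hm ⊢
  rcases block_step hG' hk with h4 | ⟨-, h5, h6⟩
  · rw [h4.2.2.1, h4.2.2.2]
    exact Prod.Lex.right _ (h1 _ _ (lastBlock_lt hG' hk) h4.2.1)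
  · rw [h6] at hm ⊢
    exact Prod.Lex.left _ _ (h2 _ _ (blockMins_lt hk) hm)

/-! ### Trees of ordinal intervals -/

section Tree

variable {ι : Type*} [Encodable ι] (T : Set (List ι)) (ρ : List ι → Ordinal.{0})

open Classical in
/-- Left end points, relative to the interval of `l`, of the intervals assigned to the children
of `l`. -/
def treeOffset (l : List ι) : ℕ → Ordinal.{0}
  | 0 => 0
  | n + 1 => treeOffset l n +
      (Encodable.decode (α := ι) n).elim 0 fun i => if i :: l ∈ T then ω ^ ρ (i :: l) else 0

/-- The left end point of the interval of `l`. -/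
def treeLeft : List ι → Ordinal.{0}
  | [] => 0
  | i :: l => treeLeft l + treeOffset T ρ l (Encodable.encode i)

/-- The interval assigned to a node of a tree. -/
def treeInterval (l : List ι) : Set Ordinal.{0} :=
  Set.Ioc (treeLeft T ρ l) (treeLeft T ρ l + ω ^ ρ l)

variable {T ρ}

theorem treeOffset_encode {i : ι} {l : List ι} (h : i :: l ∈ T) :
    treeOffset T ρ l (Encodable.encode i + 1) =
      treeOffset T ρ l (Encodable.encode i) + ω ^ ρ (i :: l) := by
  simp [treeOffset, h]

theorem treeOffset_mono (l : List ι) : Monotone (treeOffset T ρ l) :=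
  monotone_nat_of_le_succ fun _ => le_self_add

/-- A finite sum of powers of ω with exponents below ρ(l) stays below ω^ρ(l), which is additively
indecomposable. So countably many children fit, and labels cost nothing in rank. -/
theorem treeOffset_lt (hρ : ∀ i l, i :: l ∈ T → ρ (i :: l) < ρ l) (l : List ι) (n : ℕ) :
    treeOffset T ρ l n < ω ^ ρ l := by
  have h0 : (0 : Ordinal) < ω ^ ρ l := Ordinal.opow_pos _ Ordinal.omega0_pos
  induction n with
  | zero => exact h0
  | succ n ih =>
    refine Ordinal.isPrincipal_add_omega0_opow _ ih ?_
    rcases Encodable.decode (α := ι) n with _ | i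
    · exact h0
    · simp only [Option.elim_some]
      split_ifs with h
      · exact (Ordinal.opow_lt_opow_iff_right Ordinal.one_lt_omega0).2 (hρ i l h)
      · exact h0

theorem treeRight_eq {i : ι} {l : List ι} (h : i :: l ∈ T) :
    treeLeft T ρ (i :: l) + ω ^ ρ (i :: l) =
      treeLeft T ρ l + treeOffset T ρ l (Encodable.encode i + 1) := by
  rw [treeOffset_encode h, ← add_assoc, treeLeft]

theorem treeRight_lt (hρ : ∀ i l, i :: l ∈ T → ρ (i :: l) < ρ l) {i : ι} {l : List ι}
    (h : i :: l ∈ T) :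
    treeLeft T ρ (i :: l) + ω ^ ρ (i :: l) < treeLeft T ρ l + ω ^ ρ l := by
  rw [treeRight_eq h]
  exact (add_lt_add_iff_left _).2 (treeOffset_lt hρ l _)

theorem treeInterval_nonempty (l : List ι) : (treeInterval T ρ l).Nonempty :=
  ⟨_, lt_add_of_pos_right _ (Ordinal.opow_pos _ Ordinal.omega0_pos), le_rfl⟩

theorem treeInterval_cons_subset (hρ : ∀ i l, i :: l ∈ T → ρ (i :: l) < ρ l) {i : ι} {l : List ι}
    (h : i :: l ∈ T) : treeInterval T ρ (i :: l) ⊆ treeInterval T ρ l :=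
  Set.Ioc_subset_Ioc le_self_add (treeRight_lt hρ h).le

theorem treeInterval_siblings {i j : ι} {l : List ι} (hij : i ≠ j) (hi : i :: l ∈ T)
    (hj : j :: l ∈ T) : Disjoint (treeInterval T ρ (i :: l)) (treeInterval T ρ (j :: l)) := by
  wlog h : Encodable.encode i < Encodable.encode j generalizing i j
  · refine (this hij.symm hj hi (lt_of_le_of_ne (not_lt.1 h) fun h' => hij ?_)).symm
    exact (Encodable.encode_injective h').symm
  rw [Set.disjoint_left]
  rintro x ⟨-, h1⟩ ⟨h2, -⟩
  rw [treeRight_eq hi] at h1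
  refine absurd (h1.trans ?_) (not_le.2 h2)
  exact add_le_add_right (treeOffset_mono l h) _

/-- Distinct lists of equal length are siblings or have distinct tails, whose larger intervals are
already disjoint. -/
theorem treeInterval_disjoint (hT : ∀ i l, i :: l ∈ T → l ∈ T)
    (hρ : ∀ i l, i :: l ∈ T → ρ (i :: l) < ρ l) {l l' : List ι} (hl : l ∈ T) (hl' : l' ∈ T)
    (hlen : l.length = l'.length) (hne : l ≠ l') :
    Disjoint (treeInterval T ρ l) (treeInterval T ρ l') := by
  induction l generalizing l' with
  | nil => exact absurd (List.length_eq_zero_iff.1 hlen.symm).symm hne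
  | cons i l ih =>
    cases l' with
    | nil => simp at hlen
    | cons j l' =>
      by_cases h : l = l'
      · subst h
        exact treeInterval_siblings (fun h => hne (by rw [h])) hl hl'
      · exact (ih (hT _ _ hl) (hT _ _ hl') (by simpa using hlen) h).mono
          (treeInterval_cons_subset hρ hl) (treeInterval_cons_subset hρ hl')

/-- Strictness keeps the end point ω^ρ([]), where functions in `C0` vanish, outside the interval of
every node but the root. -/
theorem treeRight_lt_of_ne_nil (hT : ∀ i l, i :: l ∈ T → l ∈ T)
    (hρ : ∀ i l, i :: l ∈ T → ρ (i :: l) < ρ l) {l : List ι} (hl : l ∈ T) (hne : l ≠ []) :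
    treeLeft T ρ l + ω ^ ρ l < ω ^ ρ [] := by
  induction l with
  | nil => exact absurd rfl hne
  | cons i l ih =>
    refine (treeRight_lt hρ hl).trans_le ?_
    rcases eq_or_ne l [] with rfl | h
    · simp [treeLeft]
    · exact (ih (hT _ _ hl) h).le

end Tree

/-- (a, b] equals both [a+1, b] and (a, b+1). -/
theorem isClopen_Ioc_ordinal (a b : Ordinal.{0}) : IsClopen (Set.Ioc a b) := by
  refine ⟨?_, ?_⟩
  · rw [← Order.Icc_succ_left]
    exact isClosed_Icc
  · rw [← Order.Ioo_succ_right]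
    exact isOpen_Ioo

/-- The elements of a finite set in decreasing order. -/
def descList (E : Finset ℕ+) : List ℕ+ := E.sort (· ≥ ·)

/-- Decreasing order makes appending a new maximum a `cons`, so extending a set is passing to a
child in the tree. -/
theorem descList_insert {E : Finset ℕ+} {k : ℕ+} (h : ∀ x ∈ E, x < k) :
    descList (insert k E) = k :: descList E :=
  Finset.sort_insert (r := (· ≥ ·)) (fun x hx => (h x hx).le) (notMem_of_forall_lt h)

/-- The list of elements of `E` with labels, in decreasing order. -/
def labelledList {Λ : Type*} (E : Finset ℕ+) (σ : ℕ+ → Λ) : List (ℕ+ × Λ) :=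
  (descList E).map fun n => (n, σ n)

/-! ### Ordinal intervals attached to labelled members of a family. -/

section Intervals

variable {Λ : Type*}

variable (Λ) in
/-- The tree of labelled members of `F`. -/
def labelledTree (F : Set (Finset ℕ+)) : Set (List (ℕ+ × Λ)) :=
  {l | (l.map Prod.fst).Pairwise (· > ·) ∧ (l.map Prod.fst).toFinset ∈ F}

variable {F : Set (Finset ℕ+)} {ρ : Finset ℕ+ → Ordinal.{0}}

theorem map_fst_labelledList (E : Finset ℕ+) (σ : ℕ+ → Λ) :
    (labelledList E σ).map Prod.fst = descList E := by
  rw [labelledList, List.map_map]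
  exact List.map_id _

theorem labelledList_mem {E : Finset ℕ+} (hE : E ∈ F) (σ : ℕ+ → Λ) :
    labelledList E σ ∈ labelledTree Λ F := by
  refine ⟨?_, ?_⟩
  · rw [map_fst_labelledList]
    exact (Finset.sortedGT_sort E).pairwise
  · rw [map_fst_labelledList, descList, Finset.sort_toFinset]
    exact hE

theorem labelledTree_tail (hF : IsInitialClosed F) (i : ℕ+ × Λ) (l : List (ℕ+ × Λ))
    (h : i :: l ∈ labelledTree Λ F) : l ∈ labelledTree Λ F := by
  obtain ⟨h1, h2⟩ := h
  rw [List.map_cons, List.pairwise_cons] at h1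
  rw [List.map_cons, List.toFinset_cons] at h2
  exact ⟨h1.2, hF.of_insert _ _ (fun x hx => h1.1 x (List.mem_toFinset.1 hx)) h2⟩

theorem labelledTree_rank (hρ : IsRank F ρ) (i : ℕ+ × Λ) (l : List (ℕ+ × Λ))
    (h : i :: l ∈ labelledTree Λ F) :
    ρ ((i :: l).map Prod.fst).toFinset < ρ (l.map Prod.fst).toFinset := by
  obtain ⟨h1, h2⟩ := h
  rw [List.map_cons, List.pairwise_cons] at h1
  rw [List.map_cons, List.toFinset_cons] at h2 ⊢
  exact hρ _ _ (fun x hx => h1.1 x (List.mem_toFinset.1 hx)) h2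

variable [Encodable Λ]

variable (F ρ) in
/-- The ordinal interval assigned to a labelled member of `F`. -/
def nodeInterval (E : Finset ℕ+)
    (σ : ℕ+ → Λ) : Set Ordinal.{0} :=
  treeInterval (labelledTree Λ F) (fun l => ρ (l.map Prod.fst).toFinset) (labelledList E σ)

theorem nodeInterval_isClopen (E : Finset ℕ+) (σ : ℕ+ → Λ) : IsClopen (nodeInterval F ρ E σ) :=
  isClopen_Ioc_ordinal _ _

theorem nodeInterval_nonempty (E : Finset ℕ+) (σ : ℕ+ → Λ) : (nodeInterval F ρ E σ).Nonempty :=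
  treeInterval_nonempty _

theorem nodeInterval_lt (hF : IsInitialClosed F) (hρ : IsRank F ρ) {E : Finset ℕ+} (hE : E ∈ F)
    (hne : E.Nonempty) (σ : ℕ+ → Λ) : ∀ x ∈ nodeInterval F ρ E σ, x < ω ^ ρ ∅ := by
  intro x hx
  refine lt_of_le_of_lt hx.2 (treeRight_lt_of_ne_nil (labelledTree_tail hF) (labelledTree_rank hρ)
    (labelledList_mem hE σ) fun h => ?_)
  have := map_fst_labelledList E σ
  rw [h, List.map_nil] at this
  have h2 := Finset.sort_toFinset E (· ≥ ·)
  rw [← descList, ← this] at h2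
  simp [← h2] at hne

theorem nodeInterval_congr {E : Finset ℕ+} {σ τ : ℕ+ → Λ} (h : ∀ n ∈ E, σ n = τ n) :
    nodeInterval F ρ E σ = nodeInterval F ρ E τ := by
  rw [nodeInterval, nodeInterval]
  congr 1
  refine List.map_congr_left fun n hn => ?_
  rw [h n (by simpa [descList] using hn)]

theorem nodeInterval_insert_subset (hρ : IsRank F ρ) {E : Finset ℕ+} {k : ℕ+}
    (hk : ∀ x ∈ E, x < k) (hm : insert k E ∈ F) (σ : ℕ+ → Λ) :
    nodeInterval F ρ (insert k E) σ ⊆ nodeInterval F ρ E σ := by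
  have h : labelledList (insert k E) σ = (k, σ k) :: labelledList E σ := by
    simp [labelledList, descList_insert hk]
  rw [nodeInterval, h]
  exact treeInterval_cons_subset (labelledTree_rank hρ) (h ▸ labelledList_mem hm σ)

theorem nodeInterval_filter_le (hF : IsInitialClosed F) (hρ : IsRank F ρ) {E : Finset ℕ+}
    (hE : E ∈ F) {x : ℕ+} (hx : x ∈ E) (σ : ℕ+ → Λ) :
    nodeInterval F ρ E σ ⊆ nodeInterval F ρ (E.filter (· ≤ x)) σ := by
  induction E using Finset.induction_on_max with
  | empty => simp at hx
  | insert k E hk ih =>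
    rcases Finset.mem_insert.1 hx with rfl | hx'
    · rw [filter_le_insert_self hk]
    · rw [filter_le_insert hk hx']
      exact (nodeInterval_insert_subset hρ hk hE σ).trans (ih (hF.of_insert _ _ hk hE) hx')

/-- The lists may differ in their sets or only in their labels; the second case separates different
choices of signs on one set. -/
theorem nodeInterval_disjoint (hF : IsInitialClosed F) (hρ : IsRank F ρ) {E E' : Finset ℕ+}
    (hE : E ∈ F) (hE' : E' ∈ F) (hc : E.card = E'.card) {σ τ : ℕ+ → Λ}
    (hne : E = E' → ∃ n ∈ E, σ n ≠ τ n) :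
    Disjoint (nodeInterval F ρ E σ) (nodeInterval F ρ E' τ) := by
  refine treeInterval_disjoint (labelledTree_tail hF) (labelledTree_rank hρ)
    (labelledList_mem hE σ) (labelledList_mem hE' τ) (by simp [labelledList, descList, hc])
    fun h => ?_
  have h1 : descList E = descList E' := by
    rw [← map_fst_labelledList E σ, h, map_fst_labelledList]
  have h2 : E = E' := by
    rw [← Finset.sort_toFinset E (· ≥ ·), ← Finset.sort_toFinset E' (· ≥ ·)]
    exact congrArg List.toFinset h1
  obtain ⟨n, hn, h3⟩ := hne h2
  subst h2
  refine h3 ?_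
  have h4 := List.map_inj_left.1 h n (by simpa [descList] using hn)
  exact (Prod.mk.inj h4).2

end Intervals

/-! ### Indicator functions -/

section Indicator

variable (𝕜 : Type*) [RCLike 𝕜] (α : Ordinal.{0})

open Classical in
/-- The indicator function of a clopen set not containing `α` (and `0` for other sets). -/
def clopenIndicator (S : Set Ordinal.{0}) : C0 𝕜 α :=
  if h : IsClopen S ∧ α ∉ S then
    ⟨⟨fun x => S.indicator (fun _ => (1 : 𝕜)) x.1, by
      exact (continuous_indicator (by simp [h.1.frontier_eq]) continuousOn_const).comp
        continuous_subtype_val⟩, by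
      change S.indicator (fun _ => (1 : 𝕜)) α = 0
      simp [h.2]⟩
  else 0

variable {𝕜 α}

theorem clopenIndicator_apply {S : Set Ordinal.{0}} (h1 : IsClopen S) (h2 : α ∉ S)
    (x : Set.Icc (0 : Ordinal.{0}) α) :
    (clopenIndicator 𝕜 α S).1 x = S.indicator (fun _ => (1 : 𝕜)) x.1 := by
  rw [clopenIndicator, dif_pos ⟨h1, h2⟩]
  rfl

theorem norm_C0_le {f : C0 𝕜 α} {C : ℝ} (hC : 0 ≤ C) (h : ∀ x, ‖f.1 x‖ ≤ C) : ‖f‖ ≤ C :=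
  (ContinuousMap.norm_le f.1 hC).2 h

theorem norm_apply_le_C0 (f : C0 𝕜 α) (x : Set.Icc (0 : Ordinal.{0}) α) : ‖f.1 x‖ ≤ ‖f‖ :=
  ContinuousMap.norm_coe_le_norm f.1 x

theorem norm_clopenIndicator_le (S : Set Ordinal.{0}) : ‖clopenIndicator 𝕜 α S‖ ≤ 1 := by
  by_cases h : IsClopen S ∧ α ∉ S
  · refine norm_C0_le zero_le_one fun x => ?_
    rw [clopenIndicator_apply h.1 h.2]
    by_cases hx : x.1 ∈ S <;> simp [hx]
  · rw [clopenIndicator, dif_neg h]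
    simp

/-- A linear combination of functions in the unit ball with disjoint supports. -/
theorem norm_sum_smul_le_of_disjoint {κ : Type*} (s : Finset κ) (f : κ → C0 𝕜 α)
    (hf : ∀ k ∈ s, ‖f k‖ ≤ 1)
    (hd : ∀ j ∈ s, ∀ k ∈ s, j ≠ k → ∀ x, (f j).1 x = 0 ∨ (f k).1 x = 0) (a : κ → 𝕜)
    (ha : ∀ k ∈ s, ‖a k‖ ≤ 1) : ‖∑ k ∈ s, a k • f k‖ ≤ 1 := by
  refine norm_C0_le zero_le_one fun x => ?_
  have h1 : (∑ k ∈ s, a k • f k).1 x = ∑ k ∈ s, a k * (f k).1 x := by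
    simp
  rw [h1]
  by_cases h : ∃ j ∈ s, (f j).1 x ≠ 0
  · obtain ⟨j, hj, hjx⟩ := h
    rw [Finset.sum_eq_single_of_mem j hj, norm_mul]
    · exact mul_le_one₀ (ha j hj) (norm_nonneg _) ((norm_apply_le_C0 _ x).trans (hf j hj))
    · intro k hk hkj
      rw [(hd k hk j hj hkj x).resolve_right hjx, mul_zero]
  · push Not at h
    rw [Finset.sum_eq_zero fun k hk => by rw [h k hk, mul_zero]]
    simp

end Indicator

/-! ### Pure tensors -/

section Tensor

variable (𝕜 : Type*) [RCLike 𝕜] (X Y : Type*) [NormedAddCommGroup X] [NormedSpace 𝕜 X]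
  [NormedAddCommGroup Y] [NormedSpace 𝕜 Y]

/-- The canonical bilinear map into the algebraic tensor product. -/
def algTmul : X →ₗ[𝕜] Y →ₗ[𝕜] AlgTensor 𝕜 X Y := TensorProduct.mk 𝕜 X Y

/-- The canonical bilinear map into the projective tensor product. -/
def pureTensor : X →ₗ[𝕜] Y →ₗ[𝕜] ProjTensor 𝕜 X Y :=
  (algTmul 𝕜 X Y).compr₂ (UniformSpace.Completion.toComplₗᵢ (𝕜 := 𝕜)).toLinearMap

variable {𝕜 X Y}

theorem evalBilin_algTmul (x : X) (y : Y) (b : X →L[𝕜] Y →L[𝕜] 𝕜) :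
    evalBilin 𝕜 X Y (algTmul 𝕜 X Y x y) b = b x y := by
  rfl

theorem norm_pureTensor_le (x : X) (y : Y) : ‖pureTensor 𝕜 X Y x y‖ ≤ ‖x‖ * ‖y‖ := by
  have h1 : ‖pureTensor 𝕜 X Y x y‖ = ‖algTmul 𝕜 X Y x y‖ :=
    UniformSpace.Completion.norm_coe _
  rw [h1]
  change ‖evalBilin 𝕜 X Y (algTmul 𝕜 X Y x y)‖ ≤ _
  refine ContinuousLinearMap.opNorm_le_bound _ (by positivity) fun b => ?_
  rw [evalBilin_algTmul]
  calc ‖b x y‖ ≤ ‖b‖ * ‖x‖ * ‖y‖ := b.le_opNorm₂ x y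
    _ = _ := by ring

/-- Lower bounds for the projective norm are obtained by testing against a single bilinear form. -/
theorem norm_sum_apply_le {κ : Type*} (s : Finset κ) (a : κ → 𝕜) (f : κ → X) (g : κ → Y)
    (b : X →L[𝕜] Y →L[𝕜] 𝕜) (hb : ‖b‖ ≤ 1) :
    ‖∑ k ∈ s, a k * b (f k) (g k)‖ ≤ ‖∑ k ∈ s, a k • pureTensor 𝕜 X Y (f k) (g k)‖ := by
  have h1 : ‖∑ k ∈ s, a k • pureTensor 𝕜 X Y (f k) (g k)‖ =
      ‖∑ k ∈ s, a k • algTmul 𝕜 X Y (f k) (g k)‖ := by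
    rw [← UniformSpace.Completion.norm_coe (∑ k ∈ s, a k • algTmul 𝕜 X Y (f k) (g k))]
    congr 1
    change _ = UniformSpace.Completion.toComplₗᵢ (𝕜 := 𝕜) _
    rw [map_sum]
    refine Finset.sum_congr rfl fun k _ => ?_
    rw [map_smul]
    rfl
  have h2 : ∑ k ∈ s, a k * b (f k) (g k) =
      evalBilin 𝕜 X Y (∑ k ∈ s, a k • algTmul 𝕜 X Y (f k) (g k)) b := by
    rw [map_sum, sum_apply]
    refine Finset.sum_congr rfl fun k _ => ?_
    rw [map_smul, smul_apply, evalBilin_algTmul, smul_eq_mul]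
  rw [h1, h2]
  change _ ≤ ‖evalBilin 𝕜 X Y (∑ k ∈ s, a k • algTmul 𝕜 X Y (f k) (g k))‖
  calc _ ≤ ‖evalBilin 𝕜 X Y (∑ k ∈ s, a k • algTmul 𝕜 X Y (f k) (g k))‖ * ‖b‖ :=
        ContinuousLinearMap.le_opNorm _ _
    _ ≤ _ := mul_le_of_le_one_right (norm_nonneg _) hb

theorem add_sum_update_smul {κ : Type*} [DecidableEq κ] {s : Finset κ} {j : κ} (hj : j ∉ s)
    (θ : 𝕜) (ε : κ → 𝕜) (z : X) (h : κ → X) :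
    z + ∑ k ∈ insert j s, Function.update ε j θ k • h k = z + θ • h j + ∑ k ∈ s, ε k • h k := by
  rw [Finset.sum_insert hj, Function.update_self, add_assoc]
  congr 2
  refine Finset.sum_congr rfl fun k hk => ?_
  rw [Function.update_of_ne (ne_of_mem_of_not_mem hk hj)]

/-- A diagonal sum of a bilinear form is dominated by one of its values at signed sums. -/
theorem exists_signs_norm_le {κ : Type*} (B : X →ₗ[𝕜] Y →ₗ[𝕜] 𝕜) (f : κ → X) (g : κ → Y)
    (s : Finset κ) (x : X) (y : Y) : ∃ ε : κ → 𝕜, (∀ k, ‖ε k‖ ≤ 1) ∧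
      ‖B x y + ∑ k ∈ s, B (f k) (g k)‖ ≤
        ‖B (x + ∑ k ∈ s, ε k • f k) (y + ∑ k ∈ s, ε k • g k)‖ := by
  classical
  induction s using Finset.induction_on generalizing x y with
  | empty => exact ⟨fun _ => 1, by simp, by simp⟩
  | insert j s hj ih =>
    obtain ⟨ε₁, h1, h2⟩ := ih (x + (1 : 𝕜) • f j) (y + (1 : 𝕜) • g j)
    obtain ⟨ε₂, h3, h4⟩ := ih (x + (-1 : 𝕜) • f j) (y + (-1 : 𝕜) • g j)
    have hupd : ∀ (θ : 𝕜) (ε : κ → 𝕜), ‖θ‖ ≤ 1 → (∀ k, ‖ε k‖ ≤ 1) →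
        ∀ k, ‖Function.update ε j θ k‖ ≤ 1 := by
      intro θ ε hθ hε k
      by_cases hk : k = j
      · subst hk; simpa using hθ
      · rw [Function.update_of_ne hk]; exact hε k
    set S := ∑ k ∈ s, B (f k) (g k) with hS
    -- Polarisation: B(x+f, y+g) + B(x−f, y−g) = 2(B(x,y) + B(f,g)). One of the two shifted base
    -- points therefore does at least as well as the mean, and the induction continues from it.
    have hsum : B x y + ∑ k ∈ insert j s, B (f k) (g k) = (2 : 𝕜)⁻¹ *
        ((B (x + (1 : 𝕜) • f j) (y + (1 : 𝕜) • g j) + S) +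
          (B (x + (-1 : 𝕜) • f j) (y + (-1 : 𝕜) • g j) + S)) := by
      rw [Finset.sum_insert hj, ← hS]
      simp only [map_add, LinearMap.add_apply, map_smul, LinearMap.smul_apply, smul_eq_mul]
      field_simp
      ring
    have hle : ‖B x y + ∑ k ∈ insert j s, B (f k) (g k)‖ ≤ 2⁻¹ *
        (‖B (x + (1 : 𝕜) • f j) (y + (1 : 𝕜) • g j) + S‖ +
          ‖B (x + (-1 : 𝕜) • f j) (y + (-1 : 𝕜) • g j) + S‖) := by
      rw [hsum, norm_mul, norm_inv, RCLike.norm_ofNat]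
      gcongr
      exact norm_add_le _ _
    rcases le_total ‖B (x + (1 : 𝕜) • f j) (y + (1 : 𝕜) • g j) + S‖
      ‖B (x + (-1 : 𝕜) • f j) (y + (-1 : 𝕜) • g j) + S‖ with h | h
    · refine ⟨Function.update ε₂ j (-1), hupd _ _ (by simp) h3, ?_⟩
      rw [add_sum_update_smul hj, add_sum_update_smul hj]
      linarith
    · refine ⟨Function.update ε₁ j 1, hupd _ _ (by simp) h1, ?_⟩
      rw [add_sum_update_smul hj, add_sum_update_smul hj]
      linarith

end Tensor

/-! ### Weakly null sequences of pure tensors -/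

theorem exists_norm_le_one_mul_eq_norm {𝕜 : Type*} [RCLike 𝕜] (z : 𝕜) :
    ∃ a : 𝕜, ‖a‖ ≤ 1 ∧ a * z = (‖z‖ : 𝕜) := by
  by_cases hz : z = 0
  · exact ⟨0, by simp, by simp [hz]⟩
  · refine ⟨(‖z‖ : 𝕜) / z, by simp [hz], ?_⟩
    field_simp

theorem finite_setOf_le_of_sum_le {κ : Type*} {K : Set κ} {F : κ → ℝ} {C : ℝ}
    (h : ∀ s : Finset κ, (∀ k ∈ s, k ∈ K) → ∑ k ∈ s, F k ≤ C) {ε : ℝ} (hε : 0 < ε) :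
    {k | k ∈ K ∧ ε ≤ F k}.Finite := by
  by_contra hinf
  obtain ⟨n, hn⟩ := exists_nat_gt (C / ε)
  obtain ⟨s, hs, hcard⟩ := Set.Infinite.exists_subset_card_eq hinf n
  have h1 := h s fun k hk => (hs hk).1
  have h2 : (n : ℝ) * ε ≤ ∑ k ∈ s, F k := by
    have := Finset.card_nsmul_le_sum s F ε fun k hk => (hs hk).2
    rwa [hcard, nsmul_eq_mul] at this
  rw [div_lt_iff₀ hε] at hn
  linarith

section WeakNull

variable {𝕜 : Type*} [RCLike 𝕜] {α β : Ordinal.{0}}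

/-- Scaling the `f k` by scalars of norm at most 1 turns the sum of norms into a diagonal sum. If
`g` is constant, this is one value of `B`; if the `g k` are disjointly supported, signs bound it by
a value of `B` at two sums, each in the unit ball by disjointness. -/
theorem sum_norm_le_of_disjoint {κ : Type*} (B : C0 𝕜 α →ₗ[𝕜] C0 𝕜 β →ₗ[𝕜] 𝕜) {C : ℝ}
    (hB : ∀ x y, ‖x‖ ≤ 1 → ‖y‖ ≤ 1 → ‖B x y‖ ≤ C)
    (s : Finset κ) (f : κ → C0 𝕜 α) (g : κ → C0 𝕜 β) (hf : ∀ k ∈ s, ‖f k‖ ≤ 1)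
    (hg : ∀ k ∈ s, ‖g k‖ ≤ 1)
    (hfd : ∀ j ∈ s, ∀ k ∈ s, j ≠ k → ∀ x, (f j).1 x = 0 ∨ (f k).1 x = 0)
    (hgd : (∀ j ∈ s, ∀ k ∈ s, g j = g k) ∨
      ∀ j ∈ s, ∀ k ∈ s, j ≠ k → ∀ x, (g j).1 x = 0 ∨ (g k).1 x = 0) :
    ∑ k ∈ s, ‖B (f k) (g k)‖ ≤ C := by
  choose a ha1 ha2 using fun k => exists_norm_le_one_mul_eq_norm (B (f k) (g k))
  have hsum : ∑ k ∈ s, ‖B (f k) (g k)‖ = ‖∑ k ∈ s, B (a k • f k) (g k)‖ := by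
    have : ∑ k ∈ s, B (a k • f k) (g k) = ((∑ k ∈ s, ‖B (f k) (g k)‖ : ℝ) : 𝕜) := by
      push_cast
      refine Finset.sum_congr rfl fun k _ => ?_
      rw [map_smul, LinearMap.smul_apply, smul_eq_mul, ha2]
    rw [this, RCLike.norm_ofReal, abs_of_nonneg (Finset.sum_nonneg fun _ _ => norm_nonneg _)]
  rw [hsum]
  rcases hgd with hgd | hgd
  · rcases s.eq_empty_or_nonempty with rfl | ⟨j, hj⟩
    · simpa using (norm_nonneg _).trans (hB 0 0 (by simp) (by simp))
    have : ∑ k ∈ s, B (a k • f k) (g k) = B (∑ k ∈ s, a k • f k) (g j) := by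
      rw [map_sum, LinearMap.sum_apply]
      exact Finset.sum_congr rfl fun k hk => by rw [hgd k hk j hj]
    rw [this]
    exact hB _ _ (norm_sum_smul_le_of_disjoint s f hf hfd a fun k _ => ha1 k) (hg j hj)
  · obtain ⟨ε, h1, h2⟩ := exists_signs_norm_le B (fun k => a k • f k) g s 0 0
    simp only [LinearMap.map_zero, zero_add] at h2
    refine h2.trans (hB _ _ ?_ ?_)
    · simp only [smul_smul]
      exact norm_sum_smul_le_of_disjoint s f hf hfd _ fun k _ => by
        rw [norm_mul]; exact mul_le_one₀ (h1 k) (norm_nonneg _) (ha1 k)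
    · exact norm_sum_smul_le_of_disjoint s g hg hgd _ fun k _ => h1 k

theorem finite_setOf_le_norm (φ : StrongDual 𝕜 (ProjTensor 𝕜 (C0 𝕜 α) (C0 𝕜 β)))
    {κ : Type*} {K : Set κ} (f : κ → C0 𝕜 α) (g : κ → C0 𝕜 β) (hf : ∀ k ∈ K, ‖f k‖ ≤ 1)
    (hg : ∀ k ∈ K, ‖g k‖ ≤ 1)
    (hfd : ∀ j ∈ K, ∀ k ∈ K, j ≠ k → ∀ x, (f j).1 x = 0 ∨ (f k).1 x = 0)
    (hgd : (∀ j ∈ K, ∀ k ∈ K, g j = g k) ∨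
      ∀ j ∈ K, ∀ k ∈ K, j ≠ k → ∀ x, (g j).1 x = 0 ∨ (g k).1 x = 0) {ε : ℝ} (hε : 0 < ε) :
    {k | k ∈ K ∧ ε ≤ ‖φ (pureTensor 𝕜 _ _ (f k) (g k))‖}.Finite := by
  refine finite_setOf_le_of_sum_le (C := ‖φ‖) (fun s hs => ?_) hε
  refine sum_norm_le_of_disjoint
    ((pureTensor 𝕜 (C0 𝕜 α) (C0 𝕜 β)).compr₂ φ.toLinearMap) (fun x y hx hy => ?_) s f g (fun k hk => hf k (hs k hk)) (fun k hk => hg k (hs k hk))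
    (fun j hj k hk => hfd j (hs j hj) k (hs k hk)) ?_
  · refine (φ.le_opNorm _).trans (mul_le_of_le_one_right (norm_nonneg _) ?_)
    exact (norm_pureTensor_le x y).trans (mul_le_one₀ hx (norm_nonneg _) hy)
  exact hgd.imp (fun h j hj k hk => h j (hs j hj) k (hs k hk))
    (fun h j hj k hk => h j (hs j hj) k (hs k hk))

end WeakNull

/-! ### A bilinear form built from random signs -/

section Signs

variable {κ : Type*} [DecidableEq κ] (𝕜 : Type*) [RCLike 𝕜]

/-- The random sign attached to `a`, on the space of subsets `Q`. -/
def randomSign (Q : Finset κ) (a : κ) : 𝕜 := if a ∈ Q then 1 else -1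

variable {𝕜}

theorem sum_randomSign_mul (X : Finset κ) {a b : κ} (ha : a ∈ X) :
    ∑ Q ∈ X.powerset, randomSign 𝕜 Q a * randomSign 𝕜 Q b =
      if a = b then (2 : 𝕜) ^ X.card else 0 := by
  split_ifs with hab
  · subst hab
    have : ∀ Q : Finset κ, randomSign 𝕜 Q a * randomSign 𝕜 Q a = 1 := fun Q => by
      by_cases h : a ∈ Q <;> simp [randomSign, h]
    simp [this]
  -- Toggling `a` in `Q` flips the sign at `a` and not at `b`, so the terms cancel in pairs.
  · refine Finset.sum_involution (fun Q _ => symmDiff Q {a}) (fun Q _ => ?_) (fun Q _ _ h => ?_)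
      (fun Q hQ => ?_) (fun Q _ => ?_)
    · have h1 : randomSign 𝕜 (symmDiff Q {a}) a = -randomSign 𝕜 Q a := by
        by_cases h : a ∈ Q <;> simp [randomSign, h, Finset.mem_symmDiff]
      have h2 : randomSign 𝕜 (symmDiff Q {a}) b = randomSign 𝕜 Q b := by
        have h3 : b ≠ a := fun h => hab h.symm
        by_cases h : b ∈ Q <;> simp [randomSign, h, h3, Finset.mem_symmDiff]
      rw [h1, h2]; ring
    · have h1 := congrArg (a ∈ ·) h
      simp [Finset.mem_symmDiff] at h1
    · rw [Finset.mem_powerset] at hQ ⊢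
      intro x hx
      rcases Finset.mem_symmDiff.1 hx with h | h
      · exact hQ h.1
      · rw [Finset.mem_singleton.1 h.1]; exact ha
    · exact symmDiff_symmDiff_cancel_right _ _

theorem sum_norm_sq_randomSign (X : Finset κ) {ι : Type*} (D : Finset ι) (τ : ι → κ)
    (hτ : ∀ d ∈ D, τ d ∈ X) (hinj : Set.InjOn τ D) (a : ι → 𝕜) :
    ∑ Q ∈ X.powerset, ‖∑ d ∈ D, a d * randomSign 𝕜 Q (τ d)‖ ^ 2 =
      2 ^ X.card * ∑ d ∈ D, ‖a d‖ ^ 2 := by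
  classical
  have hconj : ∀ (Q : Finset κ) (x : κ), (starRingEnd 𝕜) (randomSign 𝕜 Q x) = randomSign 𝕜 Q x := by
    intro Q x
    by_cases h : x ∈ Q <;> simp [randomSign, h]
  have key : ((∑ Q ∈ X.powerset, ‖∑ d ∈ D, a d * randomSign 𝕜 Q (τ d)‖ ^ 2 : ℝ) : 𝕜) =
      ((2 ^ X.card * ∑ d ∈ D, ‖a d‖ ^ 2 : ℝ) : 𝕜) := by
    push_cast
    simp only [← RCLike.mul_conj, map_sum, map_mul, hconj, Finset.sum_mul_sum]
    rw [Finset.sum_comm, Finset.mul_sum]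
    refine Finset.sum_congr rfl fun d hd => ?_
    rw [Finset.sum_comm, Finset.sum_eq_single_of_mem d hd]
    · have : ∀ Q : Finset κ, a d * randomSign 𝕜 Q (τ d) *
          ((starRingEnd 𝕜) (a d) * randomSign 𝕜 Q (τ d)) =
          (a d * (starRingEnd 𝕜) (a d)) * (randomSign 𝕜 Q (τ d) * randomSign 𝕜 Q (τ d)) :=
        fun Q => by ring
      simp only [this]
      rw [← Finset.mul_sum, sum_randomSign_mul X (hτ d hd), if_pos rfl, mul_comm]
    · intro e he hne
      have : ∀ Q : Finset κ, a d * randomSign 𝕜 Q (τ d) *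
          ((starRingEnd 𝕜) (a e) * randomSign 𝕜 Q (τ e)) =
          (a d * (starRingEnd 𝕜) (a e)) * (randomSign 𝕜 Q (τ d) * randomSign 𝕜 Q (τ e)) :=
        fun Q => by ring
      simp only [this]
      rw [← Finset.mul_sum, sum_randomSign_mul X (hτ d hd),
        if_neg fun h => hne (hinj he hd h.symm), mul_zero]
  exact_mod_cast key

variable {α β : Ordinal.{0}} (X : Finset κ) {ι : Type*} (D : Finset ι) (τ : ι → κ) (w : ι → ℝ)
  (x : ι → Set.Icc (0 : Ordinal.{0}) α) (y : Finset κ → Set.Icc (0 : Ordinal.{0}) β)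

variable (𝕜) in
/-- The bilinear form `∑_d √w_d f(x_d) 𝔼 ε_d g(y)`. -/
def signForm : C0 𝕜 α →ₗ[𝕜] C0 𝕜 β →ₗ[𝕜] 𝕜 :=
  LinearMap.mk₂ 𝕜 (fun f g => ((2 : 𝕜) ^ X.card)⁻¹ * ∑ Q ∈ X.powerset,
      (∑ d ∈ D, (√(w d) : 𝕜) * f.1 (x d) * randomSign 𝕜 Q (τ d)) * g.1 (y Q))
    (fun f₁ f₂ g => by
      simp only [Finset.mul_sum, Finset.sum_mul, ← Finset.sum_add_distrib]
      refine Finset.sum_congr rfl fun Q _ => Finset.sum_congr rfl fun d _ => ?_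
      rw [Submodule.coe_add, ContinuousMap.add_apply]
      ring)
    (fun a f g => by
      simp only [Finset.mul_sum, Finset.sum_mul, smul_eq_mul]
      refine Finset.sum_congr rfl fun Q _ => Finset.sum_congr rfl fun d _ => ?_
      rw [Submodule.coe_smul, ContinuousMap.smul_apply, smul_eq_mul]
      ring)
    (fun f g₁ g₂ => by
      simp only [Finset.mul_sum, Finset.sum_mul, ← Finset.sum_add_distrib]
      refine Finset.sum_congr rfl fun Q _ => Finset.sum_congr rfl fun d _ => ?_
      rw [Submodule.coe_add, ContinuousMap.add_apply]
      ring)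
    (fun a f g => by
      simp only [Finset.mul_sum, Finset.sum_mul, smul_eq_mul]
      refine Finset.sum_congr rfl fun Q _ => Finset.sum_congr rfl fun d _ => ?_
      rw [Submodule.coe_smul, ContinuousMap.smul_apply, smul_eq_mul]
      ring)

theorem signForm_apply (f : C0 𝕜 α) (g : C0 𝕜 β) :
    signForm 𝕜 X D τ w x y f g = ((2 : 𝕜) ^ X.card)⁻¹ * ∑ Q ∈ X.powerset,
      (∑ d ∈ D, (√(w d) : 𝕜) * f.1 (x d) * randomSign 𝕜 Q (τ d)) * g.1 (y Q) := rfl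

/-- By orthogonality ∑_d √w_d f(x_d) ε_d has second moment ∑ w_d |f(x_d)|² ≤ ‖f‖². Cauchy–Schwarz
bounds its first moment, and `g` enters only through its supremum norm. This is why the weights q
are square roots. -/
theorem norm_signForm_le (hτ : ∀ d ∈ D, τ d ∈ X) (hinj : Set.InjOn τ D) (hw : ∀ d ∈ D, 0 ≤ w d)
    (hw1 : ∑ d ∈ D, w d = 1) (f : C0 𝕜 α) (g : C0 𝕜 β) :
    ‖signForm 𝕜 X D τ w x y f g‖ ≤ 1 * ‖f‖ * ‖g‖ := by
  set S : Finset κ → 𝕜 := fun Q =>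
    ∑ d ∈ D, (√(w d) : 𝕜) * f.1 (x d) * randomSign 𝕜 Q (τ d) with hS
  have h1 : ∑ Q ∈ X.powerset, ‖S Q‖ ^ 2 ≤ 2 ^ X.card * ‖f‖ ^ 2 := by
    rw [hS, sum_norm_sq_randomSign X D τ hτ hinj]
    refine mul_le_mul_of_nonneg_left ?_ (by positivity)
    calc ∑ d ∈ D, ‖(√(w d) : 𝕜) * f.1 (x d)‖ ^ 2 ≤ ∑ d ∈ D, w d * ‖f‖ ^ 2 := by
          refine Finset.sum_le_sum fun d hd => ?_
          rw [norm_mul, mul_pow, RCLike.norm_ofReal, sq_abs, Real.sq_sqrt (hw d hd)]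
          have := norm_apply_le_C0 f (x d)
          have := hw d hd
          gcongr
      _ = ‖f‖ ^ 2 := by rw [← Finset.sum_mul, hw1, one_mul]
  have h2 : (∑ Q ∈ X.powerset, ‖S Q‖) ^ 2 ≤ (2 ^ X.card * ‖f‖) ^ 2 := by
    calc _ ≤ (X.powerset.card : ℝ) * ∑ Q ∈ X.powerset, ‖S Q‖ ^ 2 := sq_sum_le_card_mul_sum_sq
      _ ≤ 2 ^ X.card * (2 ^ X.card * ‖f‖ ^ 2) := by
        rw [Finset.card_powerset]
        push_cast
        gcongr
      _ = _ := by ring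
  have h3 : ∑ Q ∈ X.powerset, ‖S Q‖ ≤ 2 ^ X.card * ‖f‖ :=
    le_of_sq_le_sq h2 (by positivity)
  rw [signForm_apply, norm_mul, norm_inv, norm_pow, RCLike.norm_ofNat,
    inv_mul_le_iff₀ (by positivity)]
  calc ‖∑ Q ∈ X.powerset, S Q * g.1 (y Q)‖ ≤ ∑ Q ∈ X.powerset, ‖S Q‖ * ‖g‖ := by
        refine norm_sum_le_of_le _ fun Q _ => ?_
        rw [norm_mul]
        exact mul_le_mul_of_nonneg_left (norm_apply_le_C0 g _) (norm_nonneg _)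
    _ = (∑ Q ∈ X.powerset, ‖S Q‖) * ‖g‖ := by rw [Finset.sum_mul]
    _ ≤ 2 ^ X.card * ‖f‖ * ‖g‖ := by gcongr
    _ = _ := by ring

/-- At the sample points `y Q` the function `g` is the sign of `e`, so orthogonality kills every
term with `d ≠ e`. -/
theorem signForm_apply_of_sign (hτ : ∀ d ∈ D, τ d ∈ X) (hinj : Set.InjOn τ D) {f : C0 𝕜 α}
    {g : C0 𝕜 β} {e : ι} (he : e ∈ D) (hf : f.1 (x e) = 1)
    (hg : ∀ Q ∈ X.powerset, g.1 (y Q) = randomSign 𝕜 Q (τ e)) :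
    signForm 𝕜 X D τ w x y f g = (√(w e) : 𝕜) := by
  have h1 : ∑ Q ∈ X.powerset,
      (∑ d ∈ D, (√(w d) : 𝕜) * f.1 (x d) * randomSign 𝕜 Q (τ d)) * g.1 (y Q) =
      ∑ d ∈ D, (√(w d) : 𝕜) * f.1 (x d) *
        ∑ Q ∈ X.powerset, randomSign 𝕜 Q (τ d) * randomSign 𝕜 Q (τ e) := by
    simp only [Finset.mul_sum]
    rw [Finset.sum_comm]
    refine Finset.sum_congr rfl fun Q hQ => ?_
    rw [hg Q hQ, Finset.sum_mul]
    exact Finset.sum_congr rfl fun d _ => by ring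
  rw [signForm_apply, h1, Finset.sum_eq_single_of_mem e he, sum_randomSign_mul X (hτ e he),
    if_pos rfl, hf]
  · field_simp
  · intro d hd hde
    rw [sum_randomSign_mul X (hτ d hd), if_neg fun h => hde (hinj hd he h), mul_zero]

/-- A lower bound for the projective norm. -/
theorem le_norm_sum_pureTensor (hτ : ∀ d ∈ D, τ d ∈ X) (hinj : Set.InjOn τ D)
    (hw : ∀ d ∈ D, 0 ≤ w d) (hw1 : ∑ d ∈ D, w d = 1) {ν : Type*} (s : Finset ν) (a : ν → ℝ)
    (f : ν → C0 𝕜 α) (g : ν → C0 𝕜 β) (δ : ν → ι) (hδ : ∀ k ∈ s, δ k ∈ D)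
    (hf : ∀ k ∈ s, (f k).1 (x (δ k)) = 1)
    (hg : ∀ k ∈ s, ∀ Q ∈ X.powerset, (g k).1 (y Q) = randomSign 𝕜 Q (τ (δ k))) :
    ∑ k ∈ s, a k * √(w (δ k)) ≤ ‖∑ k ∈ s, (a k : 𝕜) • pureTensor 𝕜 _ _ (f k) (g k)‖ := by
  have h1 := norm_sum_apply_le s (fun k => (a k : 𝕜)) f g
    ((signForm 𝕜 X D τ w x y).mkContinuous₂ 1 (norm_signForm_le X D τ w x y hτ hinj hw hw1))
    (LinearMap.mkContinuous₂_norm_le _ zero_le_one _)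
  refine le_trans ?_ h1
  have h2 : ∑ k ∈ s, (a k : 𝕜) * ((signForm 𝕜 X D τ w x y).mkContinuous₂ 1
      (norm_signForm_le X D τ w x y hτ hinj hw hw1)) (f k) (g k) =
      ((∑ k ∈ s, a k * √(w (δ k)) : ℝ) : 𝕜) := by
    push_cast
    refine Finset.sum_congr rfl fun k hk => ?_
    rw [LinearMap.mkContinuous₂_apply, signForm_apply_of_sign X D τ w x y hτ hinj (hδ k hk)
      (hf k hk) (hg k hk)]
  rw [h2, RCLike.norm_ofReal]
  exact le_abs_self _

end Signs

/-! ### Sign functions on ordinal intervals -/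

/-- Indices of the random signs attached to the elements `n` of `N`: the pairs `(n, l)`, `l ≤ n`. -/
def signIndex (N : Finset ℕ+) : Finset (ℕ+ × ℕ) :=
  N.biUnion fun n => {n} ×ˢ Finset.range ((n : ℕ) + 1)

theorem mem_signIndex {N : Finset ℕ+} {a : ℕ+ × ℕ} :
    a ∈ signIndex N ↔ a.1 ∈ N ∧ a.2 ≤ (a.1 : ℕ) := by
  simp only [signIndex, Finset.mem_biUnion, Finset.mem_product, Finset.mem_singleton,
    Finset.mem_range, Nat.lt_succ_iff]
  constructor
  · rintro ⟨n, hn, h1, h2⟩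
    exact ⟨h1 ▸ hn, h1 ▸ h2⟩
  · rintro ⟨h1, h2⟩
    exact ⟨_, h1, rfl, h2⟩

/-- The part of a choice of signs concerning `n`, used as a label. -/
def signLabel (Q : Finset (ℕ+ × ℕ)) (n : ℕ+) : Finset (ℕ+ × ℕ) := Q.filter (·.1 = n)

section SignFunctions

variable (F : Set (Finset ℕ+)) (ρ : Finset ℕ+ → Ordinal.{0}) (𝕜 : Type*) [RCLike 𝕜]

/-- The union of the intervals of the labelled set `N` over the choices of signs satisfying `p`. -/
def signSet (N : Finset ℕ+) (p : Finset (ℕ+ × ℕ) → Prop) : Set Ordinal.{0} :=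
  ⋃ Q ∈ (signIndex N).powerset, ⋃ _ : p Q, nodeInterval F ρ N (signLabel Q)

/-- The function with the value of the sign `a` on the intervals of the labelled set `N`. -/
def signFun (N : Finset ℕ+) (a : ℕ+ × ℕ) : C0 𝕜 (ω ^ ρ ∅) :=
  clopenIndicator 𝕜 _ (signSet F ρ N (a ∈ ·)) - clopenIndicator 𝕜 _ (signSet F ρ N (a ∉ ·))

variable {F ρ 𝕜}

theorem mem_signSet {N : Finset ℕ+} {p : Finset (ℕ+ × ℕ) → Prop} {x : Ordinal.{0}} :
    x ∈ signSet F ρ N p ↔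
      ∃ Q, Q ⊆ signIndex N ∧ p Q ∧ x ∈ nodeInterval F ρ N (signLabel Q) := by
  simp only [signSet, Set.mem_iUnion, Finset.mem_powerset, exists_prop]

theorem isClopen_signSet (N : Finset ℕ+) (p : Finset (ℕ+ × ℕ) → Prop) :
    IsClopen (signSet F ρ N p) := by
  -- Finiteness of the set of signs attached to `N` is essential here: an infinite union of these
  -- intervals need not be closed.
  refine Set.Finite.isClopen_biUnion (Finset.finite_toSet _) fun Q _ => ?_
  by_cases h : p Q
  · simpa [h] using nodeInterval_isClopen N (signLabel Q)
  · simp [h, isClopen_empty]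

theorem notMem_signSet (hF : IsInitialClosed F) (hρ : IsRank F ρ) {N : Finset ℕ+} (hN : N ∈ F)
    (hne : N.Nonempty) (p : Finset (ℕ+ × ℕ) → Prop) : ω ^ ρ ∅ ∉ signSet F ρ N p := by
  intro h
  obtain ⟨Q, -, -, hx⟩ := mem_signSet.1 h
  exact lt_irrefl _ (nodeInterval_lt hF hρ hN hne _ _ hx)

theorem disjoint_signSet (hF : IsInitialClosed F) (hρ : IsRank F ρ) {N : Finset ℕ+} (hN : N ∈ F)
    {a : ℕ+ × ℕ} (ha : a.1 ∈ N) :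
    Disjoint (signSet F ρ N (a ∈ ·)) (signSet F ρ N (a ∉ ·)) := by
  rw [Set.disjoint_left]
  intro x h1 h2
  obtain ⟨Q, -, hQ, hx⟩ := mem_signSet.1 h1
  obtain ⟨R, -, hR, hx'⟩ := mem_signSet.1 h2
  refine Set.disjoint_left.1 (nodeInterval_disjoint hF hρ hN hN rfl fun _ => ⟨a.1, ha, fun h => ?_⟩)
    hx hx'
  have : a ∈ signLabel R a.1 := h ▸ Finset.mem_filter.2 ⟨hQ, rfl⟩
  exact hR (Finset.mem_filter.1 this).1

theorem clopenIndicator_apply_of_notMem {α : Ordinal.{0}} {S : Set Ordinal.{0}}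
    {x : Set.Icc (0 : Ordinal.{0}) α} (hx : x.1 ∉ S) : (clopenIndicator 𝕜 α S).1 x = 0 := by
  by_cases h : IsClopen S ∧ α ∉ S
  · rw [clopenIndicator_apply h.1 h.2, Set.indicator_of_notMem hx]
  · rw [clopenIndicator, dif_neg h]
    rfl

theorem signFun_apply (N : Finset ℕ+) (a : ℕ+ × ℕ) (x : Set.Icc (0 : Ordinal.{0}) (ω ^ ρ ∅)) :
    (signFun F ρ 𝕜 N a).1 x = (clopenIndicator 𝕜 _ (signSet F ρ N (a ∈ ·))).1 x -
      (clopenIndicator 𝕜 _ (signSet F ρ N (a ∉ ·))).1 x := rfl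

theorem norm_signFun_le (hF : IsInitialClosed F) (hρ : IsRank F ρ) {N : Finset ℕ+} (hN : N ∈ F)
    {a : ℕ+ × ℕ} (ha : a.1 ∈ N) : ‖signFun F ρ 𝕜 N a‖ ≤ 1 := by
  refine norm_C0_le zero_le_one fun x => ?_
  rw [signFun_apply]
  by_cases h : x.1 ∈ signSet F ρ N (a ∈ ·)
  · rw [clopenIndicator_apply_of_notMem (Set.disjoint_left.1 (disjoint_signSet hF hρ hN ha) h),
      sub_zero]
    exact (norm_apply_le_C0 _ x).trans (norm_clopenIndicator_le _)
  · rw [clopenIndicator_apply_of_notMem h, zero_sub, norm_neg]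
    exact (norm_apply_le_C0 _ x).trans (norm_clopenIndicator_le _)

/-- In the application `Q` is a choice of signs for a whole set `N'` and `N` is an initial part of
it; the interval of `N` reads only the labels of elements of `N`. -/
theorem signFun_apply_of_mem (hF : IsInitialClosed F) (hρ : IsRank F ρ) {N N' : Finset ℕ+}
    (hN : N ∈ F) {a : ℕ+ × ℕ} (ha : a ∈ signIndex N) {Q : Finset (ℕ+ × ℕ)}
    (hQ : Q ⊆ signIndex N') {x : Set.Icc (0 : Ordinal.{0}) (ω ^ ρ ∅)}
    (hx : x.1 ∈ nodeInterval F ρ N (signLabel Q)) :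
    (signFun F ρ 𝕜 N a).1 x = randomSign 𝕜 Q a := by
  have haN := (mem_signIndex.1 ha).1
  have hx' : x.1 ∈ nodeInterval F ρ N (signLabel (Q ∩ signIndex N)) := by
    rwa [nodeInterval_congr (τ := signLabel Q)]
    intro n hn
    ext b
    simp only [signLabel, Finset.mem_filter, Finset.mem_inter]
    refine ⟨fun h => ⟨h.1.1, h.2⟩, fun h => ⟨⟨h.1, mem_signIndex.2 ⟨h.2 ▸ hn, ?_⟩⟩, h.2⟩⟩
    exact (mem_signIndex.1 (hQ h.1)).2
  rw [signFun_apply]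
  by_cases h : a ∈ Q
  · have h1 : x.1 ∈ signSet F ρ N (a ∈ ·) :=
      mem_signSet.2 ⟨_, Finset.inter_subset_right, Finset.mem_inter.2 ⟨h, ha⟩, hx'⟩
    rw [clopenIndicator_apply (isClopen_signSet _ _) (notMem_signSet hF hρ hN ⟨_, haN⟩ _),
      Set.indicator_of_mem h1,
      clopenIndicator_apply_of_notMem (Set.disjoint_left.1 (disjoint_signSet hF hρ hN haN) h1)]
    simp [randomSign, h]
  · have h1 : x.1 ∈ signSet F ρ N (a ∉ ·) :=
      mem_signSet.2 ⟨_, Finset.inter_subset_right, fun h' => h (Finset.mem_inter.1 h').1, hx'⟩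
    rw [clopenIndicator_apply_of_notMem (Set.disjoint_right.1 (disjoint_signSet hF hρ hN haN) h1),
      clopenIndicator_apply (isClopen_signSet _ _) (notMem_signSet hF hρ hN ⟨_, haN⟩ _),
      Set.indicator_of_mem h1]
    simp [randomSign, h]

theorem signFun_apply_eq_zero_or (hF : IsInitialClosed F) (hρ : IsRank F ρ) {N N' : Finset ℕ+}
    (hN : N ∈ F) (hN' : N' ∈ F) (hc : N.card = N'.card) (hne : N ≠ N') (a a' : ℕ+ × ℕ)
    (x : Set.Icc (0 : Ordinal.{0}) (ω ^ ρ ∅)) :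
    (signFun F ρ 𝕜 N a).1 x = 0 ∨ (signFun F ρ 𝕜 N' a').1 x = 0 := by
  have key : ∀ (N : Finset ℕ+) (a : ℕ+ × ℕ), (signFun F ρ 𝕜 N a).1 x ≠ 0 →
      ∃ Q, x.1 ∈ nodeInterval F ρ N (signLabel Q) := by
    intro N a h
    by_contra! hcon
    refine h ?_
    rw [signFun_apply, clopenIndicator_apply_of_notMem, clopenIndicator_apply_of_notMem, sub_zero]
    all_goals
      intro hx
      obtain ⟨Q, -, -, hQ⟩ := mem_signSet.1 hx
      exact hcon Q hQ
  by_contra! hcon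
  obtain ⟨Q, hQ⟩ := key N a hcon.1
  obtain ⟨R, hR⟩ := key N' a' hcon.2
  exact Set.disjoint_left.1 (nodeInterval_disjoint hF hρ hN hN' hc fun h => absurd h hne) hQ hR

end SignFunctions

/-- The index of the sign attached to a set. -/
def signCode (c : LimitSequences) (D : Finset ℕ+) : ℕ+ × ℕ :=
  (minElt (lastBlock (schreier c 1) D), (lastBlock (schreier c 1) D).card)

/-- The bound l ≤ n in `signIndex` is the cardinality bound for an S_1-block with minimum n. -/
theorem signCode_mem (c : LimitSequences) {D : Finset ℕ+} (hD : D.Nonempty) :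
    signCode c D ∈ signIndex (blockMins (schreier c 1) D) := by
  have h1 := isInitialClosed_schreier c 1
  exact mem_signIndex.2 ⟨minElt_lastBlock_mem_blockMins h1 hD,
    mem_schreier_one.1 (lastBlock_mem h1 D) _ (minElt_mem (lastBlock_nonempty h1 hD))⟩

/-- An element is determined by the minimum of its S_1-block and its position there: last blocks
with a common minimum are nested, so equal cardinality makes them equal. -/
theorem signCode_injOn (c : LimitSequences) (D : Finset ℕ+) :
    Set.InjOn (fun d => signCode c (D.filter (· ≤ d))) D := by
  have h1 := isInitialClosed_schreier c 1
  intro d hd d' hd' h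
  wlog hlt : d < d' generalizing d d'
  · rcases eq_or_lt_of_le (not_lt.1 hlt) with h2 | h2
    exacts [h2.symm, (this hd' hd h.symm h2).symm]
  exfalso
  obtain ⟨e1, e2⟩ := Prod.mk.inj h
  have hne : (D.filter (· ≤ d)).Nonempty := ⟨d, Finset.mem_filter.2 ⟨hd, le_rfl⟩⟩
  have hne' : (D.filter (· ≤ d')).Nonempty := ⟨d', Finset.mem_filter.2 ⟨hd', le_rfl⟩⟩
  have f1 := (lastBlock_eq_filter h1 hne).1
  have f2 := (lastBlock_eq_filter h1 hne').1
  have hsub : lastBlock (schreier c 1) (D.filter (· ≤ d)) ⊆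
      lastBlock (schreier c 1) (D.filter (· ≤ d')) := by
    intro z hz
    rw [f1] at hz
    rw [f2, ← e1]
    simp only [Finset.mem_filter] at hz ⊢
    exact ⟨⟨hz.1.1, hz.1.2.trans hlt.le⟩, hz.2⟩
  have heq := Finset.eq_of_subset_of_card_le hsub e2.ge
  have hmem : d' ∈ lastBlock (schreier c 1) (D.filter (· ≤ d')) := by
    have h3 := lastBlock_subset h1 _ (minElt_mem (lastBlock_nonempty h1 hne'))
    rw [f2]
    exact Finset.mem_filter.2 ⟨Finset.mem_filter.2 ⟨hd', le_rfl⟩, (Finset.mem_filter.1 h3).2⟩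
  rw [← heq] at hmem
  exact absurd (Finset.mem_filter.1 (lastBlock_subset h1 _ hmem)).2 (not_le.2 hlt)

/-! ### The collection of pure tensors -/

section Collection

variable (c : LimitSequences) (ξ ζ : Ordinal.{0}) (ρ σ : Finset ℕ+ → Ordinal.{0})
  (𝕜 : Type*) [RCLike 𝕜]

/-- The indicator function of the interval of the last block of `A`. -/
def leftFun (A : Finset ℕ+) : C0 𝕜 (ω ^ ρ ∅) :=
  clopenIndicator 𝕜 _
    (nodeInterval (schreier c ξ) ρ (lastBlock (schreier c ξ) A) fun _ => ())

/-- The sign function associated with the block minima of `A`. -/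
def rightFun (A : Finset ℕ+) : C0 𝕜 (ω ^ σ ∅) :=
  signFun (schreier c ζ) σ 𝕜 (blockMins (schreier c 1) (blockMins (schreier c ξ) A))
    (signCode c (blockMins (schreier c ξ) A))

open Classical in
/-- The weakly null collection used for the lower bound. -/
def tensorCollection (A : Finset ℕ+) : ProjTensor 𝕜 (C0 𝕜 (ω ^ ρ ∅)) (C0 𝕜 (ω ^ σ ∅)) :=
  if blockMins (schreier c ξ) A ∈ schreier c (1 + ζ) then
    pureTensor 𝕜 _ _ (leftFun c ξ ρ 𝕜 A) (rightFun c ξ ζ σ 𝕜 A) else 0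

variable {c ξ ζ ρ σ 𝕜}

theorem norm_rightFun_le (hσ : IsRank (schreier c ζ) σ) {A : Finset ℕ+} (hA : A.Nonempty)
    (hm : blockMins (schreier c ξ) A ∈ schreier c (1 + ζ)) : ‖rightFun c ξ ζ σ 𝕜 A‖ ≤ 1 :=
  norm_signFun_le (isInitialClosed_schreier c ζ) hσ (blockMins_mem_of_mem_one_add ζ hm)
    (mem_signIndex.1 (signCode_mem c
      (blockMins_nonempty (isInitialClosed_schreier c ξ) hA))).1

theorem norm_tensorCollection_le (hσ : IsRank (schreier c ζ) σ) {A : Finset ℕ+}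
    (hA : A.Nonempty) : ‖tensorCollection c ξ ζ ρ σ 𝕜 A‖ ≤ 1 := by
  rw [tensorCollection]
  split_ifs with h
  · exact (norm_pureTensor_le _ _).trans (mul_le_one₀ (norm_clopenIndicator_le _) (norm_nonneg _)
      (norm_rightFun_le hσ hA h))
  · simp

theorem leftFun_apply_of_mem (hρ : IsRank (schreier c ξ) ρ) {A : Finset ℕ+} (hA : A.Nonempty)
    {x : Set.Icc (0 : Ordinal.{0}) (ω ^ ρ ∅)}
    (hx : x.1 ∈ nodeInterval (schreier c ξ) ρ (lastBlock (schreier c ξ) A) fun _ => ()) :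
    (leftFun c ξ ρ 𝕜 A).1 x = 1 := by
  have hG := isInitialClosed_schreier c ξ
  have h : ω ^ ρ ∅ ∉ nodeInterval (schreier c ξ) ρ (lastBlock (schreier c ξ) A) fun _ => () :=
    fun h => lt_irrefl _ (nodeInterval_lt hG hρ (lastBlock_mem hG _) (lastBlock_nonempty hG hA) _ _ h)
  rw [leftFun, clopenIndicator_apply (nodeInterval_isClopen _ _) h, Set.indicator_of_mem hx]

theorem leftFun_apply_eq_zero_or (hρ : IsRank (schreier c ξ) ρ) {A A' : Finset ℕ+}
    (hc : (lastBlock (schreier c ξ) A).card = (lastBlock (schreier c ξ) A').card)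
    (hne : lastBlock (schreier c ξ) A ≠ lastBlock (schreier c ξ) A')
    (x : Set.Icc (0 : Ordinal.{0}) (ω ^ ρ ∅)) :
    (leftFun c ξ ρ 𝕜 A).1 x = 0 ∨ (leftFun c ξ ρ 𝕜 A').1 x = 0 := by
  have hG := isInitialClosed_schreier c ξ
  have h := nodeInterval_disjoint hG hρ (lastBlock_mem hG A) (lastBlock_mem hG A') hc
    (σ := fun _ => ()) (τ := fun _ => ()) fun h => absurd h hne
  by_cases hx : x.1 ∈ nodeInterval (schreier c ξ) ρ (lastBlock (schreier c ξ) A) fun _ => ()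
  · exact Or.inr (clopenIndicator_apply_of_notMem (Set.disjoint_left.1 h hx))
  · exact Or.inl (clopenIndicator_apply_of_notMem hx)

theorem insert_ne_insert {E : Finset ℕ+} {j k : ℕ+} (hj : ∀ x ∈ E, x < j) (hjk : j ≠ k) :
    insert j E ≠ insert k E := by
  intro h
  rcases Finset.mem_insert.1 (h ▸ Finset.mem_insert_self j E) with h' | h'
  exacts [hjk h', notMem_of_forall_lt hj h']

theorem card_insert_eq {E : Finset ℕ+} {j k : ℕ+} (hj : ∀ x ∈ E, x < j) (hk : ∀ x ∈ E, x < k) :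
    (insert j E).card = (insert k E).card := by
  rw [Finset.card_insert_of_notMem (notMem_of_forall_lt hj),
    Finset.card_insert_of_notMem (notMem_of_forall_lt hk)]

/-- Appending `k` prolongs the last S_ξ-block (`K₁`), or opens a new one, whose minimum `k` then
prolongs the last S_1-block of `D` (`K₂`) or opens a new one (`K₃`). The left factors are disjointly
supported throughout, because the last blocks are distinct of equal cardinality. The right factor is
constant on `K₁` and `K₂` and disjointly supported on `K₃`. -/
theorem weaklyNull_tensorCollection (hρ : IsRank (schreier c ξ) ρ)
    (hσ : IsRank (schreier c ζ) σ) : WeaklyNull 𝕜 (tensorCollection c ξ ζ ρ σ 𝕜) := by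
  intro E φ
  have hG := isInitialClosed_schreier c ξ
  have h1 := isInitialClosed_schreier c 1
  set D := blockMins (schreier c ξ) E with hD
  let base : Set ℕ+ := {k | (∀ x ∈ E, x < k) ∧
    blockMins (schreier c ξ) (insert k E) ∈ schreier c (1 + ζ)}
  let K₁ : Set ℕ+ := {k | k ∈ base ∧
    lastBlock (schreier c ξ) (insert k E) = insert k (lastBlock (schreier c ξ) E) ∧
    blockMins (schreier c ξ) (insert k E) = D}
  let K₂ : Set ℕ+ := {k | k ∈ base ∧ lastBlock (schreier c ξ) (insert k E) = {k} ∧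
    blockMins (schreier c ξ) (insert k E) = insert k D ∧ D.Nonempty ∧
    lastBlock (schreier c 1) (insert k D) = insert k (lastBlock (schreier c 1) D) ∧
    blockMins (schreier c 1) (insert k D) = blockMins (schreier c 1) D}
  let K₃ : Set ℕ+ := {k | k ∈ base ∧ lastBlock (schreier c ξ) (insert k E) = {k} ∧
    blockMins (schreier c ξ) (insert k E) = insert k D ∧
    blockMins (schreier c 1) (insert k D) = insert k (blockMins (schreier c 1) D)}
  have hcover : ∀ k ∈ base, k ∈ K₁ ∨ k ∈ K₂ ∨ k ∈ K₃ := by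
    intro k hk
    rcases block_step hG hk.1 with h2 | h2
    · exact Or.inl ⟨hk, h2.2.2⟩
    · rcases block_step h1 (blockMins_lt (F := schreier c ξ) hk.1) with h3 | h3
      · exact Or.inr (Or.inl ⟨hk, h2.2.1, h2.2.2, h3.1, h3.2.2⟩)
      · exact Or.inr (Or.inr ⟨hk, h2.2.1, h2.2.2, h3.2.2⟩)
  have hfn : ∀ k, ‖leftFun c ξ ρ 𝕜 (insert k E)‖ ≤ 1 := fun k => norm_clopenIndicator_le _
  have hgn : ∀ k ∈ base, ‖rightFun c ξ ζ σ 𝕜 (insert k E)‖ ≤ 1 := fun k hk =>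
    norm_rightFun_le hσ (Finset.insert_nonempty _ _) hk.2
  have hsingle : ∀ j k : ℕ+, lastBlock (schreier c ξ) (insert j E) = {j} →
      lastBlock (schreier c ξ) (insert k E) = {k} → j ≠ k → ∀ x,
      (leftFun c ξ ρ 𝕜 (insert j E)).1 x = 0 ∨ (leftFun c ξ ρ 𝕜 (insert k E)).1 x = 0 := by
    intro j k hj hk hjk
    refine leftFun_apply_eq_zero_or hρ (by rw [hj, hk]; simp) ?_
    rw [hj, hk]
    simpa using hjk
  have fin₁ : ∀ ε : ℝ, 0 < ε → {k | k ∈ K₁ ∧ ε ≤ ‖φ (pureTensor 𝕜 _ _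
      (leftFun c ξ ρ 𝕜 (insert k E)) (rightFun c ξ ζ σ 𝕜 (insert k E)))‖}.Finite := by
    intro ε hε
    refine finite_setOf_le_norm φ _ _ (fun k _ => hfn k) (fun k hk => hgn k hk.1) ?_
      (Or.inl fun j hj k hk => ?_) hε
    · intro j hj k hk hjk
      have hj' := lastBlock_lt hG hj.1.1
      refine leftFun_apply_eq_zero_or hρ ?_ ?_
      · rw [hj.2.1, hk.2.1]; exact card_insert_eq hj' (lastBlock_lt hG hk.1.1)
      · rw [hj.2.1, hk.2.1]; exact insert_ne_insert hj' hjk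
    · rw [rightFun, rightFun, hj.2.2, hk.2.2]
  have fin₂ : ∀ ε : ℝ, 0 < ε → {k | k ∈ K₂ ∧ ε ≤ ‖φ (pureTensor 𝕜 _ _
      (leftFun c ξ ρ 𝕜 (insert k E)) (rightFun c ξ ζ σ 𝕜 (insert k E)))‖}.Finite := by
    intro ε hε
    refine finite_setOf_le_norm φ _ _ (fun k _ => hfn k) (fun k hk => hgn k hk.1)
      (fun j hj k hk => hsingle j k hj.2.1 hk.2.1) (Or.inl fun j hj k hk => ?_) hε
    -- The code records only the minimum and the cardinality of the block, not the new element.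
    have hcode : ∀ i ∈ K₂, signCode c (insert i D) = (minElt (lastBlock (schreier c 1) D),
        (lastBlock (schreier c 1) D).card + 1) := by
      intro i hi
      have hlt := lastBlock_lt h1 (blockMins_lt (F := schreier c ξ) hi.1.1)
      rw [signCode, hi.2.2.2.2.1, minElt_insert hlt (lastBlock_nonempty h1 hi.2.2.2.1),
        Finset.card_insert_of_notMem (notMem_of_forall_lt hlt)]
    rw [rightFun, rightFun, hj.2.2.1, hk.2.2.1, hj.2.2.2.2.2, hk.2.2.2.2.2, hcode j hj, hcode k hk]
  have fin₃ : ∀ ε : ℝ, 0 < ε → {k | k ∈ K₃ ∧ ε ≤ ‖φ (pureTensor 𝕜 _ _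
      (leftFun c ξ ρ 𝕜 (insert k E)) (rightFun c ξ ζ σ 𝕜 (insert k E)))‖}.Finite := by
    intro ε hε
    refine finite_setOf_le_norm φ _ _ (fun k _ => hfn k) (fun k hk => hgn k hk.1)
      (fun j hj k hk => hsingle j k hj.2.1 hk.2.1) (Or.inr fun j hj k hk hjk => ?_) hε
    have hlt : ∀ i ∈ K₃, ∀ x ∈ blockMins (schreier c 1) D, x < i := fun i hi =>
      blockMins_lt (blockMins_lt hi.1.1)
    have hmem : ∀ i ∈ K₃, insert i (blockMins (schreier c 1) D) ∈ schreier c ζ := fun i hi => by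
      have := blockMins_mem_of_mem_one_add ζ hi.1.2
      rwa [hi.2.2.1, hi.2.2.2] at this
    rw [rightFun, rightFun, hj.2.2.1, hk.2.2.1, hj.2.2.2, hk.2.2.2]
    exact signFun_apply_eq_zero_or (isInitialClosed_schreier c ζ) hσ (hmem j hj) (hmem k hk)
      (card_insert_eq (hlt j hj) (hlt k hk)) (insert_ne_insert (hlt j hj) hjk) _ _
  rw [Metric.tendsto_nhds]
  intro ε hε
  have hfin := ((fin₁ ε hε).union (fin₂ ε hε)).union (fin₃ ε hε)
  obtain ⟨b, hb⟩ := hfin.bddAbove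
  obtain ⟨m, hm⟩ := E.bddAbove
  filter_upwards [eventually_gt_atTop b, eventually_gt_atTop m] with k hkb hkm
  rw [dist_zero_right, tensorCollection]
  split_ifs with h
  · by_contra hcon
    have hbase : k ∈ base := ⟨fun x hx => (hm hx).trans_lt hkm, h⟩
    refine absurd (hb ?_) (not_le.2 hkb)
    rcases hcover k hbase with h2 | h2 | h2
    exacts [Or.inl (Or.inl ⟨h2, not_lt.1 hcon⟩), Or.inl (Or.inr ⟨h2, not_lt.1 hcon⟩),
      Or.inr ⟨h2, not_lt.1 hcon⟩]
  · simpa using hε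

/-- A point belonging to the intervals of all initial parts of a given block. -/
theorem exists_block_point (hρ : IsRank (schreier c ξ) ρ) (E : Finset ℕ+) (d : ℕ+) :
    ∃ x : Set.Icc (0 : Ordinal.{0}) (ω ^ ρ ∅), ∀ y ∈ E,
      minElt (lastBlock (schreier c ξ) (E.filter (· ≤ y))) = d →
        x.1 ∈ nodeInterval (schreier c ξ) ρ (lastBlock (schreier c ξ) (E.filter (· ≤ y)))
          fun _ => () := by
  have hG := isInitialClosed_schreier c ξ
  set S := E.filter fun y => minElt (lastBlock (schreier c ξ) (E.filter (· ≤ y))) = d with hS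
  rcases S.eq_empty_or_nonempty with h0 | hne
  · refine ⟨⟨0, Set.left_mem_Icc.2 zero_le⟩, fun y hy hyd => ?_⟩
    have : y ∈ S := Finset.mem_filter.2 ⟨hy, hyd⟩
    simp [h0] at this
  obtain ⟨hz, hzd⟩ := Finset.mem_filter.1 (S.max'_mem hne)
  -- The longest initial part of the block has the smallest interval, so any point of that interval
  -- serves for all.
  set z := S.max' hne
  have hne' : ∀ y ∈ E, (E.filter (· ≤ y)).Nonempty := fun y hy =>
    ⟨y, Finset.mem_filter.2 ⟨hy, le_rfl⟩⟩
  obtain ⟨x, hx⟩ := nodeInterval_nonempty (F := schreier c ξ) (ρ := ρ)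
    (lastBlock (schreier c ξ) (E.filter (· ≤ z))) fun _ => ()
  refine ⟨⟨x, zero_le, (nodeInterval_lt hG hρ (lastBlock_mem hG _)
    (lastBlock_nonempty hG (hne' z hz)) _ x hx).le⟩, fun y hy hyd => ?_⟩
  have hyz : y ≤ z := S.le_max' _ (Finset.mem_filter.2 ⟨hy, hyd⟩)
  have e1 := (lastBlock_eq_filter hG (hne' z hz)).1
  have e2 := (lastBlock_eq_filter hG (hne' y hy)).1
  rw [hzd] at e1
  rw [hyd] at e2
  have hdy : d ≤ y := by
    have := lastBlock_subset hG _ (minElt_mem (lastBlock_nonempty hG (hne' y hy)))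
    rw [hyd] at this
    exact (Finset.mem_filter.1 this).2
  have e3 : lastBlock (schreier c ξ) (E.filter (· ≤ y)) =
      (lastBlock (schreier c ξ) (E.filter (· ≤ z))).filter (· ≤ y) := by
    rw [e1, e2]
    ext t
    simp only [Finset.mem_filter]
    exact ⟨fun h => ⟨⟨⟨h.1.1, h.1.2.trans hyz⟩, h.2⟩, h.1.2⟩, fun h => ⟨⟨h.1.1.1, h.2⟩, h.1.2⟩⟩
  rw [e3]
  refine nodeInterval_filter_le hG hρ (lastBlock_mem hG _) ?_ _ hx
  rw [e1]
  exact Finset.mem_filter.2 ⟨Finset.mem_filter.2 ⟨hy, hyz⟩, hdy⟩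

/-- The combination of the collection over a complete block has norm at least one. -/
theorem one_le_norm_sum_tensorCollection (hc : c.IsCharacteristic) (hξ₁ : ξ < ω₁)
    (hζ₁ : 1 + ζ < ω₁) (hρ : IsRank (schreier c ξ) ρ) (hσ : IsRank (schreier c ζ) σ)
    {E : Finset ℕ+} {k : ℕ+} (hE : E.Nonempty) (hk : ∀ x ∈ E, x < k)
    (hm : E ∈ conv (schreier c (1 + ζ)) (schreier c ξ))
    (hm' : insert k E ∉ conv (schreier c (1 + ζ)) (schreier c ξ)) :
    1 ≤ ‖∑ z ∈ E, ((sqrtWeight c ξ (1 + ζ) (E.filter (· ≤ z)) *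
      avgWeight c ξ (E.filter (· ≤ z)) : ℝ) : 𝕜) •
        tensorCollection c ξ ζ ρ σ 𝕜 (E.filter (· ≤ z))‖ := by
  have hG := isInitialClosed_schreier c ξ
  have h1 := isInitialClosed_schreier c 1
  have hH := isInitialClosed_schreier c ζ
  obtain ⟨s1, s2⟩ := initialSum_avgWeight_mul hc hξ₁ hζ₁ hE hk hm hm'
  have hmD := (mem_conv_iff (isRegular_schreier c (1 + ζ)) (isRegular_schreier c ξ)).1 hm
  set D := blockMins (schreier c ξ) E with hD
  set N := blockMins (schreier c 1) D with hN
  have hDne : D.Nonempty := blockMins_nonempty hG hE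
  have hNne : N.Nonempty := blockMins_nonempty h1 hDne
  have hNm : N ∈ schreier c ζ := blockMins_mem_of_mem_one_add ζ hmD
  -- `δ z` is the minimum of the S_ξ-block containing `z`; the block minima of an initial part of
  -- `E` then form an initial part of `D`.
  let δ : ℕ+ → ℕ+ := fun z => minElt (lastBlock (schreier c ξ) (E.filter (· ≤ z)))
  have hδD : ∀ z ∈ E, blockMins (schreier c ξ) (E.filter (· ≤ z)) = D.filter (· ≤ δ z) :=
    fun z hz => blockMins_filter_le hG hz
  have hδ : ∀ z ∈ E, δ z ∈ D := fun z hz => by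
    have := minElt_lastBlock_mem_blockMins hG (E := E.filter (· ≤ z))
      ⟨z, Finset.mem_filter.2 ⟨hz, le_rfl⟩⟩
    rw [hδD z hz] at this
    exact (Finset.mem_filter.1 this).1
  choose x hx using exists_block_point hρ E
  choose y hy using fun Q : Finset (ℕ+ × ℕ) => nodeInterval_nonempty (F := schreier c ζ) (ρ := σ)
    N (signLabel Q)
  let y' : Finset (ℕ+ × ℕ) → Set.Icc (0 : Ordinal.{0}) (ω ^ σ ∅) := fun Q =>
    ⟨y Q, zero_le, (nodeInterval_lt hH hσ hNm hNne _ _ (hy Q)).le⟩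
  have hDd : ∀ d ∈ D, (D.filter (· ≤ d)).Nonempty := fun d hd =>
    ⟨d, Finset.mem_filter.2 ⟨hd, le_rfl⟩⟩
  have hNd : ∀ d ∈ D, blockMins (schreier c 1) (D.filter (· ≤ d)) =
      N.filter (· ≤ minElt (lastBlock (schreier c 1) (D.filter (· ≤ d)))) := fun d hd =>
    blockMins_filter_le h1 hd
  have hNe : ∀ d ∈ D, minElt (lastBlock (schreier c 1) (D.filter (· ≤ d))) ∈ N := fun d hd => by
    have := minElt_lastBlock_mem_blockMins h1 (hDd d hd)
    rw [hNd d hd] at this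
    exact (Finset.mem_filter.1 this).1
  have hf : ∀ z ∈ E, (leftFun c ξ ρ 𝕜 (E.filter (· ≤ z))).1 (x (δ z)) = 1 := by
    intro z hz
    have hne : (E.filter (· ≤ z)).Nonempty := ⟨z, Finset.mem_filter.2 ⟨hz, le_rfl⟩⟩
    have hxz := hx (δ z) z hz rfl
    exact leftFun_apply_of_mem hρ hne hxz
  have hg : ∀ z ∈ E, ∀ Q ∈ (signIndex N).powerset,
      (rightFun c ξ ζ σ 𝕜 (E.filter (· ≤ z))).1 (y' Q) =
        randomSign 𝕜 Q (signCode c (D.filter (· ≤ δ z))) := by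
    intro z hz Q hQ
    have hd := hδ z hz
    rw [rightFun, hδD z hz]
    refine signFun_apply_of_mem hH hσ (N' := N) ?_ (signCode_mem c (hDd _ hd))
      (Finset.mem_powerset.1 hQ) ?_
    · rw [hNd _ hd]; exact hH.filter_le_mem hNm (hNe _ hd)
    · rw [hNd _ hd]; exact nodeInterval_filter_le hH hσ hNm (hNe _ hd) _ (hy Q)
  -- The weights on `D` have total 1 by `s2`; `x d` lies in the intervals of all initial parts of
  -- block `d`, and `y' Q` in the interval of the full `N` labelled by `Q`, hence in those of its
  -- initial parts.
  have key := le_norm_sum_pureTensor (𝕜 := 𝕜) (signIndex N) D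
    (fun d => signCode c (D.filter (· ≤ d))) (fun d => avgWeight c (1 + ζ) (D.filter (· ≤ d))) x y'
    (fun d hd => ?_) (signCode_injOn c D) (fun d _ => avgWeight_nonneg _ _ _) s2 E
    (fun z => sqrtWeight c ξ (1 + ζ) (E.filter (· ≤ z)) * avgWeight c ξ (E.filter (· ≤ z)))
    (fun z => leftFun c ξ ρ 𝕜 (E.filter (· ≤ z))) (fun z => rightFun c ξ ζ σ 𝕜 (E.filter (· ≤ z)))
    δ hδ hf hg
  · refine le_trans (le_of_eq ?_) (key.trans (le_of_eq ?_))
    -- Since q is the square root of w, each term q · p · √w equals w · p, and these add up to 1.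
    · rw [← s1, initialSum]
      refine Finset.sum_congr rfl fun z hz => ?_
      rw [sqrtWeight_eq, hδD z hz, mul_right_comm, Real.mul_self_sqrt (avgWeight_nonneg _ _ _)]
    · congr 1
      refine Finset.sum_congr rfl fun z hz => ?_
      rw [tensorCollection, if_pos]
      rw [hδD z hz]
      exact (isInitialClosed_schreier c _).filter_le_mem hmD (hδ z hz)
  · have := mem_signIndex.1 (signCode_mem c (hDd d hd))
    rw [hNd d hd] at this
    exact mem_signIndex.2 ⟨(Finset.mem_filter.1 this.1).1, this.2⟩

end Collection

/-! ### The lower bound -/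

theorem filter_initSeg {M : ℕ → ℕ+} (hM : StrictMono M) {n j : ℕ} (hj : j < n) :
    (initSeg M n).filter (· ≤ M j) = initSeg M (j + 1) := by
  ext x
  simp only [initSeg, Finset.mem_filter, Finset.mem_image, Finset.mem_range]
  constructor
  · rintro ⟨⟨i, -, rfl⟩, h⟩
    exact ⟨i, Nat.lt_succ_of_le (hM.le_iff_le.1 h), rfl⟩
  · rintro ⟨i, hi, rfl⟩
    exact ⟨⟨i, by omega, rfl⟩, hM.monotone (by omega)⟩

/-- The first block of an infinite set. -/
theorem cut_one_spec {F : Set (Finset ℕ+)} (hF : IsInitialClosed F) {M : ℕ → ℕ+}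
    (hM : StrictMono M) (h : ∃ n, initSeg M n ∉ F) :
    0 < cut F M 1 ∧ initSeg M (cut F M 1) ∈ F ∧ initSeg M (cut F M 1 + 1) ∉ F := by
  classical
  obtain ⟨n, hn⟩ := h
  have hdown : ∀ m n, m ≤ n → initSeg M n ∈ F → initSeg M m ∈ F := by
    intro m n hmn
    induction hmn with
    | refl => exact id
    | step _ ih =>
      intro h
      rw [initSeg_add_one] at h
      exact ih (hF.of_insert _ _ (lt_of_mem_initSeg hM _) h)
  have hcut : cut F M 1 = sSup {k | initSeg M k ∈ F} := by
    simp only [cut, initSeg, Finset.range_eq_Ico]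
  -- `sSup` of an unbounded set of naturals is 0, so the excluded initial segment is needed for
  -- `cut` to be meaningful.
  have hbdd : BddAbove {k | initSeg M k ∈ F} :=
    ⟨n, fun k hk => le_of_not_ge fun hnk => hn (hdown n k hnk hk)⟩
  have h1 : initSeg M 1 ∈ F := by
    simpa [initSeg] using hF.singleton_mem (M 0)
  rw [hcut]
  refine ⟨lt_of_lt_of_le zero_lt_one (le_csSup hbdd h1), Nat.sSup_mem ⟨1, h1⟩ hbdd, fun h => ?_⟩
  exact absurd (le_csSup hbdd h) (by omega)

theorem one_le_weakOneNorm {𝕜 : Type*} [RCLike 𝕜] {U : Type*} [NormedAddCommGroup U]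
    [NormedSpace 𝕜 U] (v : ℕ → U) (h : 1 ≤ ‖v 0‖) : 1 ≤ weakOneNorm 𝕜 v := by
  obtain ⟨φ, h1, h2⟩ := exists_dual_vector'' 𝕜 (v 0)
  refine le_trans ?_ (le_iSup₂ (f := fun (φ : StrongDual 𝕜 U) (_ : ‖φ‖ ≤ 1) =>
    ∑' n, ‖φ (v n)‖ₑ) φ h1)
  refine le_trans ?_ (ENNReal.le_tsum 0)
  rw [h2, ← ofReal_norm, RCLike.norm_ofReal, abs_norm]
  exact ENNReal.one_le_ofReal.2 h

theorem one_le_gSpace (𝕜 : Type*) [RCLike 𝕜] {c : LimitSequences} (hc : c.IsCharacteristic)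
    {ξ ζ : Ordinal.{0}} (hξ₁ : ξ < ω₁) (hζ₁ : ζ < ω₁) :
    1 ≤ gSpace 𝕜 (ProjTensor 𝕜 (C0 𝕜 (ω ^ (ω ^ ξ))) (C0 𝕜 (ω ^ (ω ^ ζ)))) c ξ (1 + ζ) := by
  have hζ₂ : 1 + ζ < ω₁ := Ordinal.isPrincipal_add_omega 1
    (Ordinal.one_lt_omega0.trans_le (Ordinal.omega0_le_omega 1)) hζ₁
  obtain ⟨ρ, hρ, hρ0⟩ := exists_isRank_schreier hc hξ₁
  obtain ⟨σ, hσ, hσ0⟩ := exists_isRank_schreier hc hζ₁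
  rw [← hρ0, ← hσ0]
  refine le_iInf₂ fun γ hγ => ?_
  -- The estimate holds along every `M`, so `L` can be the whole of ℕ+.
  have hL : StrictMono fun n : ℕ => n.succPNat := fun m n h => Nat.succPNat_lt_succPNat.2 h
  obtain ⟨M, hM, -, hle⟩ := hγ (tensorCollection c ξ ζ ρ σ 𝕜)
    (fun E hE => norm_tensorCollection_le hσ hE) (weaklyNull_tensorCollection hρ hσ) _ hL
  refine le_trans (one_le_weakOneNorm _ ?_) hle
  have hC := isInitialClosed_conv (isRegular_schreier c (1 + ζ)) (isRegular_schreier c ξ)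
  obtain ⟨h1, h2, h3⟩ := cut_one_spec hC hM (exists_initSeg_notMem_conv hc hξ₁ hζ₂ hM)
  set m := cut (conv (schreier c (1 + ζ)) (schreier c ξ)) M 1 with hm
  rw [initSeg_add_one] at h3
  have hne : (initSeg M m).Nonempty :=
    ⟨M 0, Finset.mem_image_of_mem _ (Finset.mem_range.2 h1)⟩
  have key := one_le_norm_sum_tensorCollection (𝕜 := 𝕜) hc hξ₁ hζ₂ hρ hσ hne
    (lt_of_mem_initSeg hM m) h2 h3
  rw [ContinuousLinearMap.id_apply, ellTwoAvg, zero_add, ← hm]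
  refine key.trans (le_of_eq ?_)
  congr 1
  have hcut0 : cut (conv (schreier c (1 + ζ)) (schreier c ξ)) M 0 = 0 := rfl
  rw [hcut0, ← Finset.range_eq_Ico]
  conv_lhs => rw [show initSeg M m = (Finset.range m).image M from rfl]
  rw [Finset.sum_image fun _ _ _ _ h => hM.injective h]
  refine Finset.sum_congr rfl fun j hj => ?_
  have := filter_initSeg hM (Finset.mem_range.1 hj)
  rw [initSeg] at this
  rw [this]

end SchreierTensor

end

theorem mainTheorem5 (𝕜 : Type*) [RCLike 𝕜] (c : SchreierTensor.LimitSequences)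
    (hc : c.IsCharacteristic) (ξ ζ : Ordinal.{0}) (hζξ : ζ ≤ ξ) (hξ : ξ < ω₁) :
    1 ≤ SchreierTensor.gSpace 𝕜
      (SchreierTensor.ProjTensor 𝕜 (SchreierTensor.C0 𝕜 (ω ^ (ω ^ ξ)))
        (SchreierTensor.C0 𝕜 (ω ^ (ω ^ ζ)))) c ξ (1 + ζ) :=
  SchreierTensor.one_le_gSpace 𝕜 hc hξ (hζξ.trans_lt hξ)
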